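/- Let $p,q\ge 0$ be integers, let $\mathfrak g=\mathfrak{gl}(2p|2q)$ be the complex general linear Lie superalgebra, realized on $\mathbb C^{p|q}\oplus\mathbb C^{p|q}$ as $2\times 2$ block matrices with blocks of size $p|q$. Let $\mathfrak k=\mathfrak{gl}(p|q)\oplus\mathfrak{gl}(p|q)$ be the subalgebra of block diagonal matrices, let $\mathfrak p^+$ be the space of matrices whose only non-zero block is the upper right one, and put $\mathfrak q=\mathfrak k\oplus\mathfrak p^+$. Let $\mathscr H(p,q)$ be the set of $(p,q)$-hook partitions, i.e. partitions $\lambda=(\lambda_1\ge\lambda_2\ge\cdots)$ with $\lambda_{p+1}\le q$; write $\lambda'$ for the transpose of $\lambda$. For $\lambda\in\mathscr H(p,q)$ put $$\lambda^\natural=(\lambda_1,\dots,\lambda_p,\langle\lambda_1'-p\rangle,\dots,\langle\lambda_q'-p\rangle),\qquad \langle x\rangle=\max\{x,0\},$$ and let $L(\lambda^\natural)$ be the irreducible $\mathfrak{gl}(p|q)$-module of highest weight $\sum_{i\le p}\lambda_i\epsilon_i+\sum_{j\le q}\langle\lambda'_j-p\rangle\delta_j$ with respect to the standard (upper triangular)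 Borel subalgebra. Let $W_\lambda=L(\lambda^\natural)\otimes L(\lambda^\natural)^*$ be the $\mathfrak k$-module on which the first copy of $\mathfrak{gl}(p|q)$ acts on the first factor and the second copy acts on the second factor contragrediently, that is, on the space $L(\lambda^\natural)$ through the negative supertranspose. Extend $W_\lambda$ to a $\mathfrak q$-module by letting $\mathfrak p^+$ act by zero, and let $$I_\lambda=\mathfrak U(\mathfrak g)\otimes_{\mathfrak U(\mathfrak q)}W_\lambda$$ be the generalized Verma module. Then for all $\lambda,\mu\in\mathscr H(p,q)$: if $\operatorname{Hom}_{\mathfrak k}(W_\mu,I_\lambda)\ne\{0\}$ (homomorphisms of either parity being allowed), then $\lambda\supseteq\mu$, i.e. $\lambda_i\ge\mu_i$ for all $i$. -/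

import Mathlib

open scoped TensorProduct

set_option linter.unusedSectionVars false
set_option linter.unusedSimpArgs false

noncomputable section

namespace SuperPair

/-! ### Supermatrices

An index type `ι` with a parity function `π : ι → ZMod 2` gives the superspace with homogeneous
basis indexed by `ι`, and `Matrix ι ι ℂ` is its general linear Lie superalgebra. -/

/-- The sign `(-1)^(a b)` attached to two parities. -/
def sgn (a b : ZMod 2) : ℂ := if a = 1 ∧ b = 1 then -1 else 1

lemma sgn_zero_left (b : ZMod 2) : sgn 0 b = 1 := by simp [sgn]

lemma sgn_one_one : sgn 1 1 = -1 := by simp [sgn]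

lemma sgn_mul_self (a b : ZMod 2) : sgn a b * sgn a b = 1 := by
  unfold sgn; split_ifs <;> norm_num

lemma sgn_comm (a b : ZMod 2) : sgn a b = sgn b a := by
  unfold sgn; congr 1; exact propext and_comm

lemma sgn_add (a b c : ZMod 2) : sgn (a + b) c = sgn a c * sgn b c := by
  have h : ∀ a : ZMod 2, a = 0 ∨ a = 1 := by decide
  have h2 : (1 : ZMod 2) + 1 = 0 := by decide
  rcases h a with rfl | rfl <;> rcases h b with rfl | rfl <;> rcases h c with rfl | rfl <;>
    simp [sgn, h2]

section General

variable {ι : Type} [Fintype ι]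

/-- The homogeneous supermatrices of parity `a`. -/
def homog (π : ι → ZMod 2) (a : ZMod 2) : Submodule ℂ (Matrix ι ι ℂ) where
  carrier := {X | ∀ i j, π i + π j ≠ a → X i j = 0}
  zero_mem' := fun _ _ _ => rfl
  add_mem' := fun {X Y} hX hY i j h => by simp [hX i j h, hY i j h]
  smul_mem' := fun c X hX i j h => by simp [hX i j h]

lemma homog_mul {π : ι → ZMod 2} {a b : ZMod 2} {X Y : Matrix ι ι ℂ}
    (hX : X ∈ homog π a) (hY : Y ∈ homog π b) : X * Y ∈ homog π (a + b) := by
  intro i j h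
  rw [Matrix.mul_apply]
  refine Finset.sum_eq_zero fun k _ => ?_
  by_cases h1 : π i + π k = a
  · by_cases h2 : π k + π j = b
    · exfalso
      apply h
      have h3 : ∀ x : ZMod 2, x + x = 0 := by decide
      rw [← h1, ← h2]
      linear_combination -h3 (π k)
    · rw [hY k j h2, mul_zero]
  · rw [hX i k h1, zero_mul]

/-- The component of parity `a` of a supermatrix. -/
def part (π : ι → ZMod 2) (a : ZMod 2) : Matrix ι ι ℂ →ₗ[ℂ] Matrix ι ι ℂ where
  toFun X := Matrix.of fun i j => if π i + π j = a then X i j else 0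
  map_add' X Y := by ext i j; by_cases h : π i + π j = a <;> simp [h]
  map_smul' c X := by ext i j; by_cases h : π i + π j = a <;> simp [h]

lemma part_of_mem {π : ι → ZMod 2} {a : ZMod 2} {X : Matrix ι ι ℂ} (hX : X ∈ homog π a)
    (b : ZMod 2) : part π b X = if b = a then X else 0 := by
  ext i j
  by_cases h : π i + π j = a
  · by_cases hb : b = a
    · simp [part, h, hb]
    · simp [part, h, hb, Ne.symm hb]
  · by_cases hb : b = a <;> simp [part, hb, hX i j h]

/-- The parity automorphism `X ↦ (-1)^|X| X`. -/
def flip (π : ι → ZMod 2) : Matrix ι ι ℂ →ₗ[ℂ] Matrix ι ι ℂ := part π 0 - part π 1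

lemma flip_of_mem {π : ι → ZMod 2} {a : ZMod 2} {X : Matrix ι ι ℂ} (hX : X ∈ homog π a) :
    flip π X = sgn a 1 • X := by
  have h : ∀ a : ZMod 2, a = 0 ∨ a = 1 := by decide
  rcases h a with rfl | rfl <;> simp [flip, part_of_mem hX, sgn]

/-- The supertranspose: `(A, B; C, D) ↦ (Aᵗ, -Cᵗ; Bᵗ, Dᵗ)` in the block form given by parity.
Its negative is the matrix of the action on the dual basis of the dual superspace. -/
def stranspose (π : ι → ZMod 2) : Matrix ι ι ℂ →ₗ[ℂ] Matrix ι ι ℂ where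
  toFun X := Matrix.of fun i j => sgn (π j) (π i + π j) * X j i
  map_add' X Y := by ext i j; simp [mul_add]
  map_smul' c X := by ext i j; simp [mul_left_comm]

lemma stranspose_mem {π : ι → ZMod 2} {a : ZMod 2} {X : Matrix ι ι ℂ} (hX : X ∈ homog π a) :
    stranspose π X ∈ homog π a := by
  intro i j h
  have : X j i = 0 := hX j i (by rwa [add_comm])
  simp [stranspose, this]

lemma stranspose_mul {π : ι → ZMod 2} {a b : ZMod 2} {X Y : Matrix ι ι ℂ}
    (hX : X ∈ homog π a) (hY : Y ∈ homog π b) :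
    stranspose π (X * Y) = sgn a b • (stranspose π Y * stranspose π X) := by
  ext i j
  simp only [stranspose, LinearMap.coe_mk, AddHom.coe_mk, Matrix.of_apply, Matrix.mul_apply,
    Matrix.smul_apply, smul_eq_mul, Finset.mul_sum]
  refine Finset.sum_congr rfl fun k _ => ?_
  by_cases h1 : π j + π k = a
  · by_cases h2 : π k + π i = b
    · subst h1 h2
      have key : ∀ x y z : ZMod 2, sgn y (x + y) =
          sgn (y + z) (z + x) * (sgn z (x + z) * sgn y (z + y)) := by
        have h : ∀ a : ZMod 2, a = 0 ∨ a = 1 := by decide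
        have h2 : (1 : ZMod 2) + 1 = 0 := by decide
        intro x y z
        rcases h x with rfl | rfl <;> rcases h y with rfl | rfl <;> rcases h z with rfl | rfl <;>
          simp [sgn, h2]
      rw [key (π i) (π j) (π k)]
      ring
    · rw [hY k i h2]; ring
  · rw [hX j k h1]; ring

/-! ### The enveloping superalgebra -/

/-- The defining relations `x y - (-1)^(|x||y|) y x = [x, y]` for homogeneous `x`, `y`, where
`[x, y]` is the supercommutator of supermatrices. -/
inductive Rel (π : ι → ZMod 2) :
    TensorAlgebra ℂ (Matrix ι ι ℂ) → TensorAlgebra ℂ (Matrix ι ι ℂ) → Prop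
  | bracket (a b : ZMod 2) (X Y : Matrix ι ι ℂ) (hX : X ∈ homog π a) (hY : Y ∈ homog π b) :
    Rel π
      (TensorAlgebra.ι ℂ X * TensorAlgebra.ι ℂ Y -
        sgn a b • (TensorAlgebra.ι ℂ Y * TensorAlgebra.ι ℂ X))
      (TensorAlgebra.ι ℂ (X * Y - sgn a b • (Y * X)))

/-- The universal enveloping superalgebra of the Lie superalgebra of all supermatrices. -/
def U (π : ι → ZMod 2) : Type := RingQuot (Rel π)

instance (π : ι → ZMod 2) : Ring (U π) := inferInstanceAs (Ring (RingQuot (Rel π)))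

instance (π : ι → ZMod 2) : Algebra ℂ (U π) := inferInstanceAs (Algebra ℂ (RingQuot (Rel π)))

/-- The quotient map from the tensor algebra. -/
def U.mk (π : ι → ZMod 2) : TensorAlgebra ℂ (Matrix ι ι ℂ) →ₐ[ℂ] U π :=
  RingQuot.mkAlgHom ℂ (Rel π)

/-- The canonical map from supermatrices to the enveloping superalgebra. -/
def U.of (π : ι → ZMod 2) : Matrix ι ι ℂ →ₗ[ℂ] U π :=
  (U.mk π).toLinearMap ∘ₗ TensorAlgebra.ι ℂ

lemma U.of_bracket {π : ι → ZMod 2} {a b : ZMod 2} {X Y : Matrix ι ι ℂ}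
    (hX : X ∈ homog π a) (hY : Y ∈ homog π b) :
    U.of π X * U.of π Y - sgn a b • (U.of π Y * U.of π X) =
      U.of π (X * Y - sgn a b • (Y * X)) := by
  have h : U.mk π _ = U.mk π _ := RingQuot.mkAlgHom_rel ℂ (Rel.bracket a b X Y hX hY)
  rw [map_sub, map_smul, map_mul, map_mul] at h
  exact h

/-- The parity automorphism of the enveloping superalgebra, `x ↦ (-1)^|x| x` on generators. -/
def U.parity (π : ι → ZMod 2) : U π →ₐ[ℂ] U π :=
  RingQuot.liftAlgHom ℂ ⟨TensorAlgebra.lift ℂ (U.of π ∘ₗ flip π), by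
    rintro _ _ ⟨a, b, X, Y, hX, hY⟩
    have hXY : X * Y - sgn a b • (Y * X) ∈ homog π (a + b) :=
      Submodule.sub_mem _ (homog_mul hX hY)
        (Submodule.smul_mem _ _ (by rw [add_comm]; exact homog_mul hY hX))
    have e := congrArg (U.of π) (flip_of_mem hXY)
    rw [map_smul, ← U.of_bracket hX hY] at e
    rw [TensorAlgebra.lift_ι_apply, LinearMap.comp_apply, e]
    simp only [map_sub, map_smul, map_mul, TensorAlgebra.lift_ι_apply, LinearMap.comp_apply,
      flip_of_mem hX, flip_of_mem hY, sgn_add]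
    simp only [smul_mul_assoc, mul_smul_comm, smul_smul, smul_sub]
    congr 2 <;> ring⟩

lemma U.parity_of (π : ι → ZMod 2) (X : Matrix ι ι ℂ) :
    U.parity π (U.of π X) = U.of π (flip π X) := by
  refine (RingQuot.liftAlgHom_mkAlgHom_apply ℂ _ _ _).trans ?_
  rw [TensorAlgebra.lift_ι_apply, LinearMap.comp_apply]

lemma U.parity_of_mem {π : ι → ZMod 2} {a : ZMod 2} {X : Matrix ι ι ℂ} (hX : X ∈ homog π a) :
    U.parity π (U.of π X) = sgn a 1 • U.of π X := by
  rw [U.parity_of, flip_of_mem hX, map_smul]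

lemma flip_flip (π : ι → ZMod 2) (X : Matrix ι ι ℂ) : flip π (flip π X) = X := by
  have h : ∀ a : ZMod 2, a = 0 ∨ a = 1 := by decide
  ext i j
  rcases h (π i + π j) with h | h <;> simp [flip, part, h]

lemma U.parity_parity (π : ι → ZMod 2) (u : U π) : U.parity π (U.parity π u) = u := by
  have : (U.parity π).comp (U.parity π) = AlgHom.id ℂ (U π) := by
    apply RingQuot.ringQuot_ext'
    apply TensorAlgebra.hom_ext
    ext1 X
    change U.parity π (U.parity π (U.of π X)) = U.of π X
    rw [U.parity_of, U.parity_of, flip_flip]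
  exact DFunLike.congr_fun this u

/-! ### Supermodules -/

/-- A module structure on `V` over a sub-superspace `𝔰` of supermatrices (used for Lie
subsuperalgebras): `par` is the parity operator `v ↦ (-1)^|v| v`, and `act` respects parity and
supercommutators. -/
structure SuperModule (π : ι → ZMod 2) (𝔰 : Submodule ℂ (Matrix ι ι ℂ))
    (V : Type) [AddCommGroup V] [Module ℂ V] where
  act : 𝔰 →ₗ[ℂ] Module.End ℂ V
  par : Module.End ℂ V
  par_par : ∀ v, par (par v) = v
  par_act : ∀ (a : ZMod 2) (X : 𝔰), (X : Matrix ι ι ℂ) ∈ homog π a →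
    ∀ v, par (act X v) = sgn a 1 • act X (par v)
  act_bracket : ∀ (a b : ZMod 2) (X Y Z : 𝔰), (X : Matrix ι ι ℂ) ∈ homog π a →
    (Y : Matrix ι ι ℂ) ∈ homog π b →
    (Z : Matrix ι ι ℂ) = (X : Matrix ι ι ℂ) * Y - sgn a b • ((Y : Matrix ι ι ℂ) * X) →
    ∀ v, act Z v = act X (act Y v) - sgn a b • act Y (act X v)

section Modules

variable {π : ι → ZMod 2} {V V₁ V₂ : Type} [AddCommGroup V] [Module ℂ V]
  [AddCommGroup V₁] [Module ℂ V₁] [AddCommGroup V₂] [Module ℂ V₂]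

/-- Restriction to a smaller subspace. -/
def SuperModule.restrict {𝔰 𝔱 : Submodule ℂ (Matrix ι ι ℂ)} (M : SuperModule π 𝔱 V) (h : 𝔰 ≤ 𝔱) :
    SuperModule π 𝔰 V where
  act := M.act ∘ₗ Submodule.inclusion h
  par := M.par
  par_par := M.par_par
  par_act a X hX v := M.par_act a (Submodule.inclusion h X) hX v
  act_bracket a b X Y Z hX hY hZ v :=
    M.act_bracket a b (Submodule.inclusion h X) (Submodule.inclusion h Y)
      (Submodule.inclusion h Z) hX hY hZ v

/-- The homomorphisms of parity `c`: linear maps `f` of parity `c` such that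
`f (X v) = (-1)^(|X| c) X (f v)`. -/
def SuperModule.homOfParity {𝔰 : Submodule ℂ (Matrix ι ι ℂ)} (M : SuperModule π 𝔰 V₁)
    (N : SuperModule π 𝔰 V₂) (c : ZMod 2) : Submodule ℂ (V₁ →ₗ[ℂ] V₂) where
  carrier := {f | (∀ v, N.par (f v) = sgn c 1 • f (M.par v)) ∧
    ∀ (a : ZMod 2) (X : 𝔰), (X : Matrix ι ι ℂ) ∈ homog π a →
      ∀ v, f (M.act X v) = sgn a c • N.act X (f v)}
  zero_mem' := ⟨fun v => by simp, fun a X hX v => by simp⟩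
  add_mem' := fun {f g} hf hg => ⟨fun v => by simp [hf.1 v, hg.1 v],
    fun a X hX v => by simp [hf.2 a X hX v, hg.2 a X hX v]⟩
  smul_mem' := fun r f hf => ⟨fun v => by simp [hf.1 v, smul_comm r],
    fun a X hX v => by simp [hf.2 a X hX v, smul_comm r]⟩

/-- The superspace of all homomorphisms: sums of even and odd ones. -/
def SuperModule.Hom {𝔰 : Submodule ℂ (Matrix ι ι ℂ)} (M : SuperModule π 𝔰 V₁)
    (N : SuperModule π 𝔰 V₂) : Submodule ℂ (V₁ →ₗ[ℂ] V₂) :=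
  M.homOfParity N 0 ⊔ M.homOfParity N 1

/-- A `U π`-module with a compatible parity operator is a supermodule over all supermatrices. -/
def SuperModule.ofU [Module (U π) V] [IsScalarTower ℂ (U π) V]
    (P : V →ₛₗ[(U.parity π : U π →+* U π)] V) (hP : ∀ v, P (P v) = v) : SuperModule π ⊤ V where
  act := (Algebra.lsmul ℂ ℂ V).toLinearMap ∘ₗ U.of π ∘ₗ Submodule.subtype ⊤
  par :=
    { toFun := P
      map_add' := P.map_add
      map_smul' := fun c v => by
        rw [← algebraMap_smul (U π) c v, P.map_smulₛₗ]
        simp }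
  par_par := hP
  par_act a X hX v := by
    change P (U.of π X • v) = sgn a 1 • (U.of π X • P v)
    rw [P.map_smulₛₗ]
    change U.parity π (U.of π X) • P v = _
    rw [U.parity_of_mem hX, smul_assoc]
  act_bracket a b X Y Z hX hY hZ v := by
    change U.of π Z • v = U.of π X • U.of π Y • v - sgn a b • (U.of π Y • U.of π X • v)
    rw [hZ, ← U.of_bracket hX hY, sub_smul, smul_assoc, mul_smul, mul_smul]

/-- The contragredient twist: the same superspace, `X` acting through its negative
supertranspose. -/
def SuperModule.contragredient (M : SuperModule π ⊤ V) : SuperModule π ⊤ V where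
  act := M.act ∘ₗ (LinearMap.codRestrict ⊤ (-stranspose π) fun _ => trivial) ∘ₗ
    Submodule.subtype ⊤
  par := M.par
  par_par := M.par_par
  par_act a X hX v := M.par_act a _ (Submodule.neg_mem _ (stranspose_mem hX)) v
  act_bracket a b X Y Z hX hY hZ v := by
    refine M.act_bracket a b _ _ _ (Submodule.neg_mem _ (stranspose_mem hX))
      (Submodule.neg_mem _ (stranspose_mem hY)) ?_ v
    change -(stranspose π Z) = -(stranspose π X) * -(stranspose π Y) -
      sgn a b • (-(stranspose π Y) * -(stranspose π X))
    rw [hZ, map_sub, map_smul, stranspose_mul hX hY, stranspose_mul hY hX, smul_smul,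
      sgn_comm b a, sgn_mul_self]
    simp

/-! ### Induction -/

/-- The `U π`-submodule of `U π ⊗ V` spanned by `u X ⊗ v - u ⊗ X v` for `X` in `𝔰`. -/
def SuperModule.balanced {𝔰 : Submodule ℂ (Matrix ι ι ℂ)} (M : SuperModule π 𝔰 V) :
    Submodule (U π) (U π ⊗[ℂ] V) :=
  Submodule.span (U π)
    {z | ∃ (u : U π) (X : 𝔰) (v : V),
      z = (u * U.of π (X : Matrix ι ι ℂ)) ⊗ₜ[ℂ] v - u ⊗ₜ[ℂ] (M.act X v)}

/-- The underlying space of the module induced from `𝔰` to all supermatrices: the tensor product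
of `U π` and `V` over the enveloping superalgebra of `𝔰` (which is generated by `𝔰`). -/
abbrev SuperModule.IndSpace {𝔰 : Submodule ℂ (Matrix ι ι ℂ)} (M : SuperModule π 𝔰 V) : Type :=
  (U π ⊗[ℂ] V) ⧸ M.balanced

/-- The parity operator on `U π ⊗ V`. -/
def SuperModule.tensorParity {𝔰 : Submodule ℂ (Matrix ι ι ℂ)} (M : SuperModule π 𝔰 V) :
    (U π ⊗[ℂ] V) →ₛₗ[(U.parity π : U π →+* U π)] (U π ⊗[ℂ] V) where
  toFun := TensorProduct.map (U.parity π).toLinearMap M.par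
  map_add' := map_add _
  map_smul' u z := by
    induction z using TensorProduct.induction_on with
    | zero => simp
    | tmul x v => simp [TensorProduct.smul_tmul']
    | add x y hx hy => rw [smul_add, map_add, hx, hy, map_add, smul_add]

lemma SuperModule.tensorParity_tmul {𝔰 : Submodule ℂ (Matrix ι ι ℂ)} (M : SuperModule π 𝔰 V)
    (u : U π) (v : V) : M.tensorParity (u ⊗ₜ[ℂ] v) = U.parity π u ⊗ₜ[ℂ] M.par v := rfl

lemma SuperModule.tensorParity_tensorParity {𝔰 : Submodule ℂ (Matrix ι ι ℂ)}
    (M : SuperModule π 𝔰 V) (z : U π ⊗[ℂ] V) : M.tensorParity (M.tensorParity z) = z := by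
  induction z using TensorProduct.induction_on with
  | zero => simp
  | tmul x v => rw [tensorParity_tmul, tensorParity_tmul, U.parity_parity, M.par_par]
  | add x y hx hy => rw [map_add, map_add, hx, hy]

/-- A subspace of supermatrices is graded if it contains the homogeneous components of its
elements. -/
def IsGraded (π : ι → ZMod 2) (𝔰 : Submodule ℂ (Matrix ι ι ℂ)) : Prop :=
  ∀ X ∈ 𝔰, ∀ a, part π a X ∈ 𝔰

lemma part_mem (π : ι → ZMod 2) (a : ZMod 2) (X : Matrix ι ι ℂ) : part π a X ∈ homog π a := by
  intro i j h
  simp [part, h]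

lemma part_add_part (π : ι → ZMod 2) (X : Matrix ι ι ℂ) : part π 0 X + part π 1 X = X := by
  have h : ∀ a : ZMod 2, a = 0 ∨ a = 1 := by decide
  ext i j
  rcases h (π i + π j) with h | h <;> simp [part, h]

lemma SuperModule.balanced_le {𝔰 : Submodule ℂ (Matrix ι ι ℂ)} (M : SuperModule π 𝔰 V)
    (h𝔰 : IsGraded π 𝔰) : M.balanced ≤ M.balanced.comap M.tensorParity := by
  refine Submodule.span_le.2 ?_
  rintro _ ⟨u, X, v, rfl⟩
  have key : ∀ (a : ZMod 2) (Y : 𝔰), (Y : Matrix ι ι ℂ) ∈ homog π a →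
      M.tensorParity ((u * U.of π (Y : Matrix ι ι ℂ)) ⊗ₜ[ℂ] v - u ⊗ₜ[ℂ] (M.act Y v)) ∈
        M.balanced := by
    intro a Y hY
    have e : M.tensorParity ((u * U.of π (Y : Matrix ι ι ℂ)) ⊗ₜ[ℂ] v - u ⊗ₜ[ℂ] (M.act Y v)) =
        (U.parity π u * U.of π (((sgn a 1 • Y : 𝔰) : Matrix ι ι ℂ))) ⊗ₜ[ℂ] M.par v -
          U.parity π u ⊗ₜ[ℂ] (M.act (sgn a 1 • Y) (M.par v)) := by
      rw [map_sub, tensorParity_tmul, tensorParity_tmul, map_mul, U.parity_of_mem hY,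
        M.par_act a Y hY, Submodule.coe_smul, map_smul, map_smul, LinearMap.smul_apply]
    rw [e]
    exact Submodule.subset_span ⟨_, _, _, rfl⟩
  have hX : X = ⟨part π 0 X, h𝔰 X X.2 0⟩ + ⟨part π 1 X, h𝔰 X X.2 1⟩ :=
    Subtype.ext (part_add_part π X).symm
  have h0 := key 0 ⟨part π 0 X, h𝔰 X X.2 0⟩ (part_mem π 0 X)
  have h1 := key 1 ⟨part π 1 X, h𝔰 X X.2 1⟩ (part_mem π 1 X)
  have := Submodule.add_mem _ h0 h1
  rw [← map_add] at this
  change M.tensorParity _ ∈ M.balanced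
  convert this using 2
  conv_lhs => rw [hX]
  simp only [Submodule.coe_add, map_add, mul_add, TensorProduct.add_tmul, LinearMap.add_apply,
    TensorProduct.tmul_add]
  abel

/-- The induced module, with `U π` acting by left multiplication. -/
def SuperModule.Ind {𝔰 : Submodule ℂ (Matrix ι ι ℂ)} (M : SuperModule π 𝔰 V)
    (h𝔰 : IsGraded π 𝔰) : SuperModule π ⊤ M.IndSpace :=
  SuperModule.ofU (Submodule.mapQ M.balanced M.balanced M.tensorParity (M.balanced_le h𝔰)) <| by
    intro z
    induction z using Submodule.Quotient.induction_on with
    | H z => rw [Submodule.mapQ_apply, Submodule.mapQ_apply, M.tensorParity_tensorParity]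

end Modules

end General

/-! ### Irreducible highest weight modules of `gl(p|q)` -/

section HighestWeight

variable (p q : ℕ)

/-- The parity function of `ℂ^(p|q)`. -/
def parity : Fin p ⊕ Fin q → ZMod 2 := Sum.elim (fun _ => 0) (fun _ => 1)

variable {p q}

/-- The left ideal generated by the strictly upper triangular matrix units (the order of the
basis is `ε₁ … ε_p δ₁ … δ_q`) and by `E_ii - κ_i`. -/
def vermaIdeal (κ : Fin p ⊕ Fin q → ℂ) : Submodule (U (parity p q)) (U (parity p q)) :=
  Submodule.span (U (parity p q))
    ({x | ∃ i j, Sum.Lex (· < ·) (· < ·) i j ∧ x = U.of (parity p q) (Matrix.single i j 1)} ∪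
      {x | ∃ i, x = U.of (parity p q) (Matrix.single i i 1) - algebraMap ℂ _ (κ i)})

/-- The Verma module of highest weight `κ` with respect to the standard Borel subalgebra. -/
abbrev Verma (κ : Fin p ⊕ Fin q → ℂ) : Type := U (parity p q) ⧸ vermaIdeal κ

/-- The sum of all proper submodules of the Verma module. -/
def vermaRadical (κ : Fin p ⊕ Fin q → ℂ) : Submodule (U (parity p q)) (Verma κ) :=
  sSup {N | N ≠ ⊤}

/-- The irreducible module of highest weight `κ`, as a space. -/
abbrev LSpace (κ : Fin p ⊕ Fin q → ℂ) : Type := Verma κ ⧸ vermaRadical κ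

/-- The parity operator on the enveloping superalgebra as a semilinear map. -/
def uParity : U (parity p q) →ₛₗ[(U.parity (parity p q) : U (parity p q) →+* U (parity p q))]
    U (parity p q) where
  toFun := U.parity (parity p q)
  map_add' := map_add _
  map_smul' := map_mul _

lemma single_mem_homog (i j : Fin p ⊕ Fin q) :
    Matrix.single i j (1 : ℂ) ∈ homog (parity p q) (parity p q i + parity p q j) := by
  intro k l h
  refine Matrix.single_apply_of_ne _ _ _ _ _ ?_
  rintro ⟨rfl, rfl⟩
  exact h rfl

lemma vermaIdeal_le (κ : Fin p ⊕ Fin q → ℂ) : vermaIdeal κ ≤ (vermaIdeal κ).comap uParity := by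
  refine Submodule.span_le.2 ?_
  rintro _ (⟨i, j, hij, rfl⟩ | ⟨i, rfl⟩)
  · change U.parity (parity p q) _ ∈ vermaIdeal κ
    rw [U.parity_of_mem (single_mem_homog i j), ← algebraMap_smul (U (parity p q))]
    exact Submodule.smul_mem _ _ (Submodule.subset_span (Or.inl ⟨i, j, hij, rfl⟩))
  · change U.parity (parity p q) _ ∈ vermaIdeal κ
    have h : ∀ x : ZMod 2, x + x = 0 := by decide
    rw [map_sub, U.parity_of_mem (single_mem_homog i i), h, sgn_zero_left, one_smul,
      AlgHom.commutes]
    exact Submodule.subset_span (Or.inr ⟨i, rfl⟩)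

/-- The parity operator on the Verma module; the highest weight vector is even. -/
def vermaParity (κ : Fin p ⊕ Fin q → ℂ) :
    Verma κ →ₛₗ[(U.parity (parity p q) : U (parity p q) →+* U (parity p q))] Verma κ :=
  Submodule.mapQ _ _ uParity (vermaIdeal_le κ)

lemma vermaParity_vermaParity (κ : Fin p ⊕ Fin q → ℂ) (z : Verma κ) :
    vermaParity κ (vermaParity κ z) = z := by
  induction z using Submodule.Quotient.induction_on with
  | H z =>
    rw [vermaParity, Submodule.mapQ_apply, Submodule.mapQ_apply]
    exact congrArg _ (U.parity_parity _ z)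

lemma vermaRadical_le (κ : Fin p ⊕ Fin q → ℂ) :
    vermaRadical κ ≤ (vermaRadical κ).comap (vermaParity κ) := by
  refine sSup_le fun N hN n hn => ?_
  have h1 : N.comap (vermaParity κ) ≠ ⊤ := by
    intro h
    apply hN
    rw [eq_top_iff]
    intro m _
    have : vermaParity κ m ∈ N.comap (vermaParity κ) := h ▸ Submodule.mem_top
    rwa [Submodule.mem_comap, vermaParity_vermaParity] at this
  refine (le_sSup (α := Submodule _ _) h1 : _ ≤ vermaRadical κ) ?_
  rwa [Submodule.mem_comap, vermaParity_vermaParity]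

/-- The irreducible `gl(p|q)`-module of highest weight `κ` with respect to the standard Borel
subalgebra; the highest weight vector is even. -/
def L (κ : Fin p ⊕ Fin q → ℂ) : SuperModule (parity p q) ⊤ (LSpace κ) :=
  SuperModule.ofU (Submodule.mapQ _ _ (vermaParity κ) (vermaRadical_le κ)) <| by
    intro z
    induction z using Submodule.Quotient.induction_on with
    | H z => rw [Submodule.mapQ_apply, Submodule.mapQ_apply, vermaParity_vermaParity]

end HighestWeight

/-! ### The symmetric pair

`gl(2p|2q)` is realized on the superspace `ℂ^(p|q) ⊕ ℂ^(p|q)`, so that its elements are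
`2 × 2` block matrices whose blocks are supermatrices of size `p|q`. -/

section Pair

variable (p q : ℕ)

/-- The parity function of `ℂ^(p|q) ⊕ ℂ^(p|q) = ℂ^(2p|2q)`. -/
def parity₂ : (Fin p ⊕ Fin q) ⊕ (Fin p ⊕ Fin q) → ZMod 2 := Sum.elim (parity p q) (parity p q)

/-- `gl(2p|2q)` as a space of supermatrices. -/
abbrev G : Type := Matrix ((Fin p ⊕ Fin q) ⊕ (Fin p ⊕ Fin q)) ((Fin p ⊕ Fin q) ⊕ (Fin p ⊕ Fin q)) ℂ

/-- `𝔨 = gl(p|q) ⊕ gl(p|q)`, the block diagonal matrices. -/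
def 𝔨 : Submodule ℂ (G p q) where
  carrier := {X | ∀ i j, X (Sum.inl i) (Sum.inr j) = 0 ∧ X (Sum.inr i) (Sum.inl j) = 0}
  zero_mem' := fun _ _ => ⟨rfl, rfl⟩
  add_mem' := fun {X Y} hX hY i j => by simp [(hX i j).1, (hX i j).2, (hY i j).1, (hY i j).2]
  smul_mem' := fun c X hX i j => by simp [(hX i j).1, (hX i j).2]

/-- `𝔮 = 𝔨 ⊕ 𝔭⁺`, the block upper triangular matrices. -/
def 𝔮 : Submodule ℂ (G p q) where
  carrier := {X | ∀ i j, X (Sum.inr i) (Sum.inl j) = 0}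
  zero_mem' := fun _ _ => rfl
  add_mem' := fun {X Y} hX hY i j => by simp [hX i j, hY i j]
  smul_mem' := fun c X hX i j => by simp [hX i j]

lemma isGraded_𝔮 : IsGraded (parity₂ p q) (𝔮 p q) := by
  intro X hX a i j
  simp [part, hX i j]

variable {p q}

/-- The upper left block. -/
def blk₁ : G p q →ₗ[ℂ] Matrix (Fin p ⊕ Fin q) (Fin p ⊕ Fin q) ℂ where
  toFun X := X.toBlocks₁₁
  map_add' _ _ := rfl
  map_smul' _ _ := rfl

/-- The lower right block. -/
def blk₂ : G p q →ₗ[ℂ] Matrix (Fin p ⊕ Fin q) (Fin p ⊕ Fin q) ℂ where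
  toFun X := X.toBlocks₂₂
  map_add' _ _ := rfl
  map_smul' _ _ := rfl

lemma blk₁_mem {a : ZMod 2} {X : G p q} (hX : X ∈ homog (parity₂ p q) a) :
    blk₁ X ∈ homog (parity p q) a := fun i j h => hX (Sum.inl i) (Sum.inl j) h

lemma blk₂_mem {a : ZMod 2} {X : G p q} (hX : X ∈ homog (parity₂ p q) a) :
    blk₂ X ∈ homog (parity p q) a := fun i j h => hX (Sum.inr i) (Sum.inr j) h

lemma blk₁_mul {X Y : G p q} (hY : Y ∈ 𝔮 p q) : blk₁ (X * Y) = blk₁ X * blk₁ Y := by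
  ext i j
  have h : ∀ k l, Y (Sum.inr k) (Sum.inl l) = 0 := hY
  simp [blk₁, Matrix.toBlocks₁₁, Matrix.mul_apply, h]

lemma blk₂_mul {X Y : G p q} (hX : X ∈ 𝔮 p q) : blk₂ (X * Y) = blk₂ X * blk₂ Y := by
  ext i j
  have h : ∀ k l, X (Sum.inr k) (Sum.inl l) = 0 := hX
  simp [blk₂, Matrix.toBlocks₂₂, Matrix.mul_apply, h]

lemma 𝔨_le_𝔮 : 𝔨 p q ≤ 𝔮 p q := fun _ hX i j => (hX i j).2

/-- The projection of `𝔮 = 𝔨 ⊕ 𝔭⁺` to `𝔨`. -/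
def levi : 𝔮 p q →ₗ[ℂ] 𝔨 p q where
  toFun X := ⟨Matrix.fromBlocks (blk₁ (X : G p q)) 0 0 (blk₂ (X : G p q)), fun _ _ => ⟨rfl, rfl⟩⟩
  map_add' X Y := by
    apply Subtype.ext
    change _ = Matrix.fromBlocks _ _ _ _ + Matrix.fromBlocks _ _ _ _
    rw [Matrix.fromBlocks_add]; simp
  map_smul' c X := by
    apply Subtype.ext
    change _ = c • Matrix.fromBlocks _ _ _ _
    rw [Matrix.fromBlocks_smul]; simp

lemma levi_mem {a : ZMod 2} {X : 𝔮 p q} (hX : (X : G p q) ∈ homog (parity₂ p q) a) :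
    (levi X : G p q) ∈ homog (parity₂ p q) a := by
  rintro (i | i) (j | j) h
  · exact hX _ _ h
  · rfl
  · rfl
  · exact hX _ _ h

section

variable {V V₁ V₂ : Type} [AddCommGroup V] [Module ℂ V]
  [AddCommGroup V₁] [Module ℂ V₁] [AddCommGroup V₂] [Module ℂ V₂]

/-- Extension of a `𝔨`-module to `𝔮`, with `𝔭⁺` acting by zero. -/
def inflate (M : SuperModule (parity₂ p q) (𝔨 p q) V) : SuperModule (parity₂ p q) (𝔮 p q) V where
  act := M.act ∘ₗ levi
  par := M.par
  par_par := M.par_par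
  par_act a X hX v := M.par_act a (levi X) (levi_mem hX) v
  act_bracket a b X Y Z hX hY hZ v := by
    refine M.act_bracket a b (levi X) (levi Y) (levi Z) (levi_mem hX) (levi_mem hY) ?_ v
    change Matrix.fromBlocks (blk₁ (Z : G p q)) 0 0 (blk₂ (Z : G p q)) =
      Matrix.fromBlocks (blk₁ (X : G p q)) 0 0 (blk₂ (X : G p q)) *
        Matrix.fromBlocks (blk₁ (Y : G p q)) 0 0 (blk₂ (Y : G p q)) -
      sgn a b • (Matrix.fromBlocks (blk₁ (Y : G p q)) 0 0 (blk₂ (Y : G p q)) *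
        Matrix.fromBlocks (blk₁ (X : G p q)) 0 0 (blk₂ (X : G p q)))
    rw [hZ, map_sub, map_sub, map_smul, map_smul, blk₁_mul Y.2, blk₁_mul X.2, blk₂_mul X.2,
      blk₂_mul Y.2, Matrix.fromBlocks_multiply, Matrix.fromBlocks_multiply,
      Matrix.fromBlocks_smul, sub_eq_add_neg (Matrix.fromBlocks _ _ _ _),
      Matrix.fromBlocks_neg, Matrix.fromBlocks_add]
    simp [sub_eq_add_neg]

/-- A supermatrix as an element of the full space of supermatrices. -/
abbrev full (X : Matrix (Fin p ⊕ Fin q) (Fin p ⊕ Fin q) ℂ) :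
    (⊤ : Submodule ℂ (Matrix (Fin p ⊕ Fin q) (Fin p ⊕ Fin q) ℂ)) := ⟨X, trivial⟩

lemma full_add (X Y : Matrix (Fin p ⊕ Fin q) (Fin p ⊕ Fin q) ℂ) :
    full (X + Y) = full X + full Y := rfl

lemma full_smul (c : ℂ) (X : Matrix (Fin p ⊕ Fin q) (Fin p ⊕ Fin q) ℂ) :
    full (c • X) = c • full X := rfl

/-- The action of `X = (X₁, X₂)` in `𝔨` on an outer tensor product:
`X (v ⊗ w) = X₁ v ⊗ w + (-1)^(|X₂||v|) v ⊗ X₂ w`. -/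
def outerAct (M : SuperModule (parity p q) ⊤ V₁) (N : SuperModule (parity p q) ⊤ V₂) :
    𝔨 p q →ₗ[ℂ] Module.End ℂ (V₁ ⊗[ℂ] V₂) where
  toFun X :=
    TensorProduct.map (M.act (full (blk₁ X))) LinearMap.id +
    TensorProduct.map LinearMap.id (N.act (full (part (parity p q) 0 (blk₂ X)))) +
    TensorProduct.map M.par (N.act (full (part (parity p q) 1 (blk₂ X))))
  map_add' X Y := by
    simp only [Submodule.coe_add, map_add, full_add, TensorProduct.map_add_left,
      TensorProduct.map_add_right]
    abel
  map_smul' c X := by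
    simp only [Submodule.coe_smul, map_smul, full_smul, TensorProduct.map_smul_left,
      TensorProduct.map_smul_right, smul_add, RingHom.id_apply]

lemma outerAct_tmul_zero (M : SuperModule (parity p q) ⊤ V₁) (N : SuperModule (parity p q) ⊤ V₂)
    {X : 𝔨 p q} (hX : (X : G p q) ∈ homog (parity₂ p q) 0) (v : V₁) (w : V₂) :
    outerAct M N X (v ⊗ₜ w) =
      M.act (full (blk₁ X)) v ⊗ₜ w + v ⊗ₜ N.act (full (blk₂ X)) w := by
  have h : full (0 : Matrix (Fin p ⊕ Fin q) (Fin p ⊕ Fin q) ℂ) = 0 := rfl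
  simp [outerAct, part_of_mem (blk₂_mem hX), h]

lemma outerAct_tmul_one (M : SuperModule (parity p q) ⊤ V₁) (N : SuperModule (parity p q) ⊤ V₂)
    {X : 𝔨 p q} (hX : (X : G p q) ∈ homog (parity₂ p q) 1) (v : V₁) (w : V₂) :
    outerAct M N X (v ⊗ₜ w) =
      M.act (full (blk₁ X)) v ⊗ₜ w + M.par v ⊗ₜ N.act (full (blk₂ X)) w := by
  have h : full (0 : Matrix (Fin p ⊕ Fin q) (Fin p ⊕ Fin q) ℂ) = 0 := rfl
  simp [outerAct, part_of_mem (blk₂_mem hX), h]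

/-- The outer tensor product of two `gl(p|q)`-modules, a module over
`𝔨 = gl(p|q) ⊕ gl(p|q)`. -/
def outer (M : SuperModule (parity p q) ⊤ V₁) (N : SuperModule (parity p q) ⊤ V₂) :
    SuperModule (parity₂ p q) (𝔨 p q) (V₁ ⊗[ℂ] V₂) where
  act := outerAct M N
  par := TensorProduct.map M.par N.par
  par_par z := by
    induction z using TensorProduct.induction_on with
    | zero => simp
    | tmul v w => simp [M.par_par, N.par_par]
    | add x y hx hy => simp [hx, hy]
  par_act a X hX z := by
    have h2 : ∀ a : ZMod 2, a = 0 ∨ a = 1 := by decide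
    have hM := M.par_act a (full (blk₁ X)) (blk₁_mem hX)
    have hN := N.par_act a (full (blk₂ X)) (blk₂_mem hX)
    induction z using TensorProduct.induction_on with
    | zero => simp
    | tmul v w =>
      rcases h2 a with rfl | rfl
      · rw [outerAct_tmul_zero M N hX, TensorProduct.map_tmul, outerAct_tmul_zero M N hX]
        simp [hM, hN, sgn]
      · rw [outerAct_tmul_one M N hX, TensorProduct.map_tmul, outerAct_tmul_one M N hX]
        simp [hM, hN, sgn, TensorProduct.neg_tmul, TensorProduct.tmul_neg]
    | add x y hx hy => rw [map_add, map_add, hx, hy, map_add, map_add, smul_add]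
  act_bracket a b X Y Z hX hY hZ z := by
    have h2 : ∀ a : ZMod 2, a = 0 ∨ a = 1 := by decide
    have hXq := 𝔨_le_𝔮 X.2
    have hYq := 𝔨_le_𝔮 Y.2
    have hZh : (Z : G p q) ∈ homog (parity₂ p q) (a + b) := by
      rw [hZ]
      exact Submodule.sub_mem _ (homog_mul hX hY)
        (Submodule.smul_mem _ _ (by rw [add_comm]; exact homog_mul hY hX))
    have hM := M.act_bracket a b (full (blk₁ X)) (full (blk₁ Y)) (full (blk₁ Z))
      (blk₁_mem hX) (blk₁_mem hY)
      (by change blk₁ _ = _; rw [hZ, map_sub, map_smul, blk₁_mul hYq, blk₁_mul hXq])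
    have hN := N.act_bracket a b (full (blk₂ X)) (full (blk₂ Y)) (full (blk₂ Z))
      (blk₂_mem hX) (blk₂_mem hY)
      (by change blk₂ _ = _; rw [hZ, map_sub, map_smul, blk₂_mul hXq, blk₂_mul hYq])
    have pX := M.par_act a (full (blk₁ X)) (blk₁_mem hX)
    have pY := M.par_act b (full (blk₁ Y)) (blk₁_mem hY)
    have h11 : (1 : ZMod 2) + 1 = 0 := by decide
    induction z using TensorProduct.induction_on with
    | zero => simp
    | tmul v w =>
      rcases h2 a with rfl | rfl <;> rcases h2 b with rfl | rfl
      · rw [add_zero] at hZh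
        simp only [outerAct_tmul_zero M N hX, outerAct_tmul_zero M N hY,
          outerAct_tmul_zero M N hZh, map_add, hM, hN, pX, pY, sgn_zero_left, one_smul,
          TensorProduct.sub_tmul, TensorProduct.tmul_sub]
        abel
      · rw [zero_add] at hZh
        simp only [outerAct_tmul_zero M N hX, outerAct_tmul_one M N hY,
          outerAct_tmul_one M N hZh, map_add, hM, hN, pX, pY, sgn_zero_left, one_smul,
          TensorProduct.sub_tmul, TensorProduct.tmul_sub]
        abel
      · rw [add_zero] at hZh
        simp only [outerAct_tmul_one M N hX, outerAct_tmul_zero M N hY,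
          outerAct_tmul_one M N hZh, map_add, hM, hN, pX, pY, sgn_zero_left, one_smul,
          sgn_comm 1 0, TensorProduct.sub_tmul, TensorProduct.tmul_sub]
        abel
      · rw [h11] at hZh
        simp only [outerAct_tmul_one M N hX, outerAct_tmul_one M N hY,
          outerAct_tmul_zero M N hZh, map_add, hM, hN, pX, pY, M.par_par, sgn_one_one,
          neg_smul, one_smul, sub_neg_eq_add,
          TensorProduct.add_tmul, TensorProduct.tmul_add, TensorProduct.neg_tmul]
        abel
    | add x y hx hy =>
      simp only [map_add, hx, hy, smul_add]
      abel

end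

/-! ### Hook partitions and the modules `W_λ`, `I_λ` -/

/-- The weight `λ^♮ = (λ₁, …, λ_p, ⟨λ'₁ - p⟩, …, ⟨λ'_q - p⟩)` with `⟨x⟩ = max x 0`. -/
def natWeight (lam : YoungDiagram) : Fin p ⊕ Fin q → ℂ :=
  Sum.elim (fun i => (lam.rowLen i : ℂ)) (fun j => ((lam.colLen j - p : ℕ) : ℂ))

variable (p q)

/-- `(p, q)`-hook partitions: `λ_{p+1} ≤ q` (rows are numbered from `0`). -/
def IsHook (lam : YoungDiagram) : Prop := lam.rowLen p ≤ q

/-- The `𝔨`-module `W_λ = L(λ^♮) ⊗ L(λ^♮)^*`. -/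
def W (lam : YoungDiagram) : SuperModule (parity₂ p q) (𝔨 p q)
    (LSpace (natWeight (p := p) (q := q) lam) ⊗[ℂ] LSpace (natWeight (p := p) (q := q) lam)) :=
  outer (L (natWeight lam)) (L (natWeight lam)).contragredient

/-- The generalized Verma module `I_λ`, induced from `W_λ` extended to `𝔮 = 𝔨 ⊕ 𝔭⁺` by the zero
action of `𝔭⁺`. -/
def I (lam : YoungDiagram) : SuperModule (parity₂ p q) ⊤ (inflate (W p q lam)).IndSpace :=
  (inflate (W p q lam)).Ind (isGraded_𝔮 p q)

end Pair

end SuperPair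

/-! Since `𝔭⁻` (the lower left block) is an abelian complement of `𝔮`, the module `I_λ` can be
modelled on `S ⊗ W_λ`, where `S` is the supersymmetric algebra of `𝔭⁻`. The upper left copy of
`gl(p|q)` acts on `𝔭⁻` by right multiplication only. A matrix unit of `𝔭⁻` in column `b` therefore
has weight minus the `b`-th coordinate weight, and a raising operator `E_ij` moves a generator from
column `i` to the later column `j`.

A nonzero homomorphism of `W_μ` into `I_λ` gives a nonzero vector of `S ⊗ W_λ` of weight `μ^♮`
killed by the upper left raising operators: the image of the highest weight vector tensored with a
suitable `y`. Grade `S` by giving a generator in column `b` the degree `ht b`, the position of `b`.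
A raising operator is a sum of a part acting on `S`, which strictly increases the degree, and a part
acting on `W_λ`, which preserves it. Hence the component of lowest degree is annihilated by the
second part alone (`exists_lTensor_singular`), so its entries in `L(λ^♮)` are singular.

Irreducibility forces singular vectors of `L(λ^♮)` to have weight `λ^♮` (`singular_weight`). So the
lowest component has weight `λ^♮` minus the numbers of generators in the various columns, and also
weight `μ^♮`. All coordinates of `λ^♮ - μ^♮` are thus natural numbers (`natWeight_sub_eq_natCast`),
and for hook partitions this gives containment (`le_of_natWeight`). -/

namespace SuperPair

/-! ### The supersymmetric algebra of the quotient by a subalgebra -/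

section SuperSymmetric

variable {ι : Type} [Fintype ι]

lemma sgn_add_right (a b c : ZMod 2) : sgn a (b + c) = sgn a b * sgn a c := by
  rw [sgn_comm, sgn_add, sgn_comm b, sgn_comm c]

lemma sgn_ne_zero (a b : ZMod 2) : sgn a b ≠ 0 := by
  unfold sgn; split_ifs <;> norm_num

/-- The supercommutator of two supermatrices of parities `a` and `b`. -/
abbrev sbr (a b : ZMod 2) (X Y : Matrix ι ι ℂ) : Matrix ι ι ℂ := X * Y - sgn a b • (Y * X)

lemma sbr_mem {π : ι → ZMod 2} {a b : ZMod 2} {X Y : Matrix ι ι ℂ}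
    (hX : X ∈ homog π a) (hY : Y ∈ homog π b) : sbr a b X Y ∈ homog π (a + b) :=
  Submodule.sub_mem _ (homog_mul hX hY)
    (Submodule.smul_mem _ _ (by rw [add_comm]; exact homog_mul hY hX))

/-- A linear map on supermatrices is determined by its values on homogeneous ones. -/
lemma linearMap_eq_of_homog (π : ι → ZMod 2) {V : Type*} [AddCommGroup V] [Module ℂ V]
    {f g : Matrix ι ι ℂ →ₗ[ℂ] V} (h : ∀ a, ∀ X ∈ homog π a, f X = g X) : f = g := by
  ext1 X
  rw [← part_add_part π X, map_add, map_add, h 0 _ (part_mem π 0 X), h 1 _ (part_mem π 1 X)]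

/-- The map `X ↦ (-1)^(|X| b) X`. -/
def twist (π : ι → ZMod 2) (b : ZMod 2) : Matrix ι ι ℂ →ₗ[ℂ] Matrix ι ι ℂ :=
  part π 0 + sgn 1 b • part π 1

lemma twist_of_mem {π : ι → ZMod 2} {a : ZMod 2} {X : Matrix ι ι ℂ} (hX : X ∈ homog π a)
    (b : ZMod 2) : twist π b X = sgn a b • X := by
  have h : ∀ a : ZMod 2, a = 0 ∨ a = 1 := by decide
  rcases h a with rfl | rfl <;> simp [twist, part_of_mem hX, sgn_zero_left]

/-- `d` projects supermatrices along the subalgebra `𝔮` onto a space of supermatrices with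
vanishing products. -/
structure IsAbelianProjection (π : ι → ZMod 2) (𝔮 : Submodule ℂ (Matrix ι ι ℂ))
    (d : Matrix ι ι ℂ →ₗ[ℂ] Matrix ι ι ℂ) : Prop where
  sub_mem : ∀ X, X - d X ∈ 𝔮
  eq_zero : ∀ X ∈ 𝔮, d X = 0
  isGraded : IsGraded π 𝔮
  homog_mem : ∀ a, ∀ X ∈ homog π a, d X ∈ homog π a
  mul_eq_zero : ∀ X Y, d X * d Y = 0
  mul_mem : ∀ X ∈ 𝔮, ∀ Y ∈ 𝔮, X * Y ∈ 𝔮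

/-- The defining relations of the supersymmetric algebra of the quotient of all supermatrices
by `𝔮`. -/
inductive SymRel (π : ι → ZMod 2) (𝔮 : Submodule ℂ (Matrix ι ι ℂ)) :
    TensorAlgebra ℂ (Matrix ι ι ℂ) → TensorAlgebra ℂ (Matrix ι ι ℂ) → Prop
  | comm (a b : ZMod 2) (X Y : Matrix ι ι ℂ) (hX : X ∈ homog π a) (hY : Y ∈ homog π b) :
    SymRel π 𝔮 (TensorAlgebra.ι ℂ X * TensorAlgebra.ι ℂ Y)
      (sgn a b • (TensorAlgebra.ι ℂ Y * TensorAlgebra.ι ℂ X))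
  | zero (X : Matrix ι ι ℂ) (hX : X ∈ 𝔮) : SymRel π 𝔮 (TensorAlgebra.ι ℂ X) 0

/-- The supersymmetric algebra of the quotient of all supermatrices by `𝔮`. -/
def SuperSym (π : ι → ZMod 2) (𝔮 : Submodule ℂ (Matrix ι ι ℂ)) : Type := RingQuot (SymRel π 𝔮)

variable {π : ι → ZMod 2} {𝔮 : Submodule ℂ (Matrix ι ι ℂ)}

instance : Ring (SuperSym π 𝔮) := inferInstanceAs (Ring (RingQuot (SymRel π 𝔮)))

instance : Algebra ℂ (SuperSym π 𝔮) := inferInstanceAs (Algebra ℂ (RingQuot (SymRel π 𝔮)))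

namespace SuperSym

/-- The quotient map from the tensor algebra. -/
def mk (π : ι → ZMod 2) (𝔮 : Submodule ℂ (Matrix ι ι ℂ)) :
    TensorAlgebra ℂ (Matrix ι ι ℂ) →ₐ[ℂ] SuperSym π 𝔮 :=
  RingQuot.mkAlgHom ℂ (SymRel π 𝔮)

lemma mk_surjective : Function.Surjective (mk π 𝔮) :=
  RingQuot.mkAlgHom_surjective ℂ (SymRel π 𝔮)

/-- The image of a supermatrix in the supersymmetric algebra. -/
def gen (π : ι → ZMod 2) (𝔮 : Submodule ℂ (Matrix ι ι ℂ)) :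
    Matrix ι ι ℂ →ₗ[ℂ] SuperSym π 𝔮 :=
  (mk π 𝔮).toLinearMap ∘ₗ TensorAlgebra.ι ℂ

lemma gen_mul_gen {a b : ZMod 2} {X Y : Matrix ι ι ℂ} (hX : X ∈ homog π a)
    (hY : Y ∈ homog π b) : gen π 𝔮 X * gen π 𝔮 Y = sgn a b • (gen π 𝔮 Y * gen π 𝔮 X) := by
  have h : mk π 𝔮 _ = mk π 𝔮 _ := RingQuot.mkAlgHom_rel ℂ (SymRel.comm a b X Y hX hY)
  rw [map_smul, map_mul, map_mul] at h
  exact h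

lemma gen_eq_zero {X : Matrix ι ι ℂ} (hX : X ∈ 𝔮) : gen π 𝔮 X = 0 := by
  have h : mk π 𝔮 _ = mk π 𝔮 _ := RingQuot.mkAlgHom_rel ℂ (SymRel.zero X hX)
  rw [map_zero] at h
  exact h

/-- The universal property of the supersymmetric algebra. -/
def lift {B : Type*} [Semiring B] [Algebra ℂ B] (g : Matrix ι ι ℂ →ₗ[ℂ] B)
    (hcomm : ∀ a b, ∀ X ∈ homog π a, ∀ Y ∈ homog π b, g X * g Y = sgn a b • (g Y * g X))
    (hzero : ∀ X ∈ 𝔮, g X = 0) : SuperSym π 𝔮 →ₐ[ℂ] B :=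
  RingQuot.liftAlgHom ℂ ⟨TensorAlgebra.lift ℂ g, by
    rintro _ _ (⟨a, b, X, Y, hX, hY⟩ | ⟨X, hX⟩)
    · simp only [map_smul, map_mul, TensorAlgebra.lift_ι_apply]
      exact hcomm a b X hX Y hY
    · simp only [map_zero, TensorAlgebra.lift_ι_apply]
      exact hzero X hX⟩

lemma lift_gen {B : Type*} [Semiring B] [Algebra ℂ B] (g : Matrix ι ι ℂ →ₗ[ℂ] B)
    (hcomm : ∀ a b, ∀ X ∈ homog π a, ∀ Y ∈ homog π b, g X * g Y = sgn a b • (g Y * g X))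
    (hzero : ∀ X ∈ 𝔮, g X = 0) (X : Matrix ι ι ℂ) :
    lift g hcomm hzero (gen π 𝔮 X) = g X := by
  refine (RingQuot.liftAlgHom_mkAlgHom_apply ℂ _ _ _).trans ?_
  rw [TensorAlgebra.lift_ι_apply]

variable {V : Type} [AddCommGroup V] [Module ℂ V]

/-- A subspace of `S ⊗ V` containing `1 ⊗ V` and stable under homogeneous generators of the
supersymmetric algebra `S` is everything. -/
lemma tensor_eq_top (P : Submodule ℂ (SuperSym π 𝔮 ⊗[ℂ] V)) (h1 : ∀ v, 1 ⊗ₜ[ℂ] v ∈ P)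
    (hgen : ∀ b, ∀ Y ∈ homog π b, ∀ t ∈ P, gen π 𝔮 Y • t ∈ P) : P = ⊤ := by
  have key : ∀ u : TensorAlgebra ℂ (Matrix ι ι ℂ), ∀ t ∈ P, mk π 𝔮 u • t ∈ P := by
    intro u
    induction u using TensorAlgebra.induction with
    | algebraMap r =>
      intro t ht
      rw [AlgHom.commutes, algebraMap_smul]
      exact P.smul_mem r ht
    | ι X =>
      intro t ht
      change gen π 𝔮 X • t ∈ P
      rw [← part_add_part π X, map_add, add_smul]
      exact P.add_mem (hgen 0 _ (part_mem π 0 X) t ht) (hgen 1 _ (part_mem π 1 X) t ht)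
    | mul x y hx hy =>
      intro t ht
      rw [map_mul, mul_smul]
      exact hx _ (hy t ht)
    | add x y hx hy =>
      intro t ht
      rw [map_add, add_smul]
      exact P.add_mem (hx t ht) (hy t ht)
  rw [eq_top_iff]
  intro t _
  induction t using TensorProduct.induction_on with
  | zero => exact P.zero_mem
  | tmul u v =>
    obtain ⟨u, rfl⟩ := mk_surjective u
    have := key u _ (h1 v)
    rwa [TensorProduct.smul_tmul', smul_eq_mul, mul_one] at this
  | add x y hx hy => exact P.add_mem (hx trivial) (hy trivial)

lemma tensor_linearMap_eq {V' : Type*} [AddCommGroup V'] [Module ℂ V']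
    {f g : SuperSym π 𝔮 ⊗[ℂ] V →ₗ[ℂ] V'} (h1 : ∀ v, f (1 ⊗ₜ v) = g (1 ⊗ₜ v))
    (hgen : ∀ b, ∀ Y ∈ homog π b, ∀ t, f t = g t → f (gen π 𝔮 Y • t) = g (gen π 𝔮 Y • t)) :
    f = g := by
  have : LinearMap.eqLocus f g = ⊤ := tensor_eq_top _ h1 hgen
  refine LinearMap.ext fun t => ?_
  have ht : t ∈ LinearMap.eqLocus f g := this ▸ Submodule.mem_top
  exact ht

end SuperSym

/-! ### The action on the tensor product of the supersymmetric algebra and a module -/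

section Step

variable {N : Type*} [AddCommGroup N] [Module ℂ N]

/-- The part of `actStep` coming from the component of parity `b`. -/
def actStepPart (π : ι → ZMod 2) (d : Matrix ι ι ℂ →ₗ[ℂ] Matrix ι ι ℂ)
    (g : Matrix ι ι ℂ →ₗ[ℂ] Module.End ℂ N) (b : ZMod 2) :
    Matrix ι ι ℂ →ₗ[ℂ] Module.End ℂ (Matrix ι ι ℂ →ₗ[ℂ] N) :=
  LinearMap.mk₂ ℂ (fun y R => R ∘ₗ LinearMap.mulRight ℂ (d (part π b y)) -
      R ∘ₗ LinearMap.mulLeft ℂ (d (part π b y)) ∘ₗ twist π b + g (part π b y) ∘ₗ R ∘ₗ twist π b)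
    (fun y y' R => by ext1 X; simp [mul_add, add_mul]; abel)
    (fun c y R => by ext1 X; simp [smul_add, smul_sub])
    (fun y R R' => by ext1 X; simp; abel)
    (fun c y R => by ext1 X; simp [smul_add, smul_sub])

/-- If `R X` is the action of `X` on a vector `t`, then `actStep π d g Y R X` is the action of `X`
on the product of `d Y` and `t`, where `g` gives the action of the range of `d`. -/
def actStep (π : ι → ZMod 2) (d : Matrix ι ι ℂ →ₗ[ℂ] Matrix ι ι ℂ)
    (g : Matrix ι ι ℂ →ₗ[ℂ] Module.End ℂ N) :
    Matrix ι ι ℂ →ₗ[ℂ] Module.End ℂ (Matrix ι ι ℂ →ₗ[ℂ] N) :=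
  actStepPart π d g 0 + actStepPart π d g 1

lemma actStep_apply (d : Matrix ι ι ℂ →ₗ[ℂ] Matrix ι ι ℂ)
    (g : Matrix ι ι ℂ →ₗ[ℂ] Module.End ℂ N) {c b : ZMod 2} {X Y : Matrix ι ι ℂ}
    (hX : X ∈ homog π c) (hY : Y ∈ homog π b) (R : Matrix ι ι ℂ →ₗ[ℂ] N) :
    actStep π d g Y R X = R (sbr c b X (d Y)) + sgn c b • g Y (R X) := by
  have h : ∀ a : ZMod 2, a = 0 ∨ a = 1 := by decide
  rcases h b with rfl | rfl <;>
    simp [actStep, actStepPart, part_of_mem hY, twist_of_mem hX]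

/-- This makes the rule `X (Y t) = [X, dY] t ± Y (X t)` consistent with the relations of `S`.
Regarding it as an operator on functions `X ↦ X t` turns a recursion over monomials into an algebra
homomorphism out of `S`. -/
lemma actStep_comm {d : Matrix ι ι ℂ →ₗ[ℂ] Matrix ι ι ℂ} (hd : IsAbelianProjection π 𝔮 d)
    (g : Matrix ι ι ℂ →ₗ[ℂ] Module.End ℂ N)
    (hg : ∀ a b, ∀ X ∈ homog π a, ∀ Y ∈ homog π b, g X * g Y = sgn a b • (g Y * g X))
    {a b : ZMod 2} {Y Z : Matrix ι ι ℂ} (hY : Y ∈ homog π a) (hZ : Z ∈ homog π b) :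
    actStep π d g Y * actStep π d g Z = sgn a b • (actStep π d g Z * actStep π d g Y) := by
  ext1 R
  refine linearMap_eq_of_homog π fun c X hX => ?_
  have hYX := sbr_mem hX (hd.homog_mem a Y hY)
  have hZX := sbr_mem hX (hd.homog_mem b Z hZ)
  have hyz : g Y (g Z (R X)) = sgn a b • g Z (g Y (R X)) :=
    LinearMap.congr_fun (hg a b Y hY Z hZ) (R X)
  have e1 := actStep_apply d g hX hY (actStep π d g Z R)
  have e2 := actStep_apply d g hX hZ (actStep π d g Y R)
  rw [actStep_apply d g hX hZ R, actStep_apply d g hYX hZ R] at e1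
  rw [actStep_apply d g hX hY R, actStep_apply d g hZX hY R] at e2
  simp only [Module.End.mul_apply, LinearMap.smul_apply]
  rw [e1, e2]
  -- Products of elements in the range of `d` vanish, so only `dY X dZ` and `dZ X dY` survive in the
  -- double bracket, and these are exchanged up to sign.
  have m : sbr (c + a) b (sbr c a X (d Y)) (d Z) =
      sgn a b • sbr (c + b) a (sbr c b X (d Z)) (d Y) := by
    simp only [sbr, sub_mul, mul_sub, smul_mul_assoc, mul_smul_comm, mul_assoc,
      hd.mul_eq_zero, mul_zero, ← mul_assoc (d _) (d _), zero_mul, smul_zero, sub_zero, zero_sub,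
      sgn_add, smul_sub, smul_neg, smul_smul]
    rw [sgn_comm b a]
    have := sgn_mul_self a b
    rw [show sgn a b * (sgn c a * sgn a b) = sgn c a * (sgn a b * sgn a b) by ring, this, mul_one,
      show sgn a b * sgn c b = sgn c b * sgn a b by ring]
    abel
  rw [m]
  simp only [map_add, map_smul, smul_add, smul_smul, hyz, sgn_add, sgn_comm b a]
  have := sgn_mul_self a b
  rw [show sgn a b * (sgn c a * sgn a b) = sgn c a * (sgn a b * sgn a b) by ring, this, mul_one,
    show sgn c a * (sgn c b * sgn a b) = sgn a b * (sgn c b * sgn c a) by ring,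
    show sgn a b * sgn c b = sgn c b * sgn a b by ring]
  abel

end Step

end SuperSymmetric

end SuperPair

namespace SuperPair

/-! ### The action of all supermatrices on `S ⊗ V` -/

namespace IsAbelianProjection

variable {ι : Type} [Fintype ι] {π : ι → ZMod 2} {𝔮 : Submodule ℂ (Matrix ι ι ℂ)}
  {d : Matrix ι ι ℂ →ₗ[ℂ] Matrix ι ι ℂ} {V : Type} [AddCommGroup V] [Module ℂ V]

lemma map_map (hd : IsAbelianProjection π 𝔮 d) (X : Matrix ι ι ℂ) : d (d X) = d X := by
  have := hd.eq_zero _ (hd.sub_mem X)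
  rw [map_sub, sub_eq_zero] at this
  exact this.symm

lemma gen_map (hd : IsAbelianProjection π 𝔮 d) (X : Matrix ι ι ℂ) :
    SuperSym.gen π 𝔮 (d X) = SuperSym.gen π 𝔮 X := by
  have := SuperSym.gen_eq_zero (π := π) (hd.sub_mem X)
  rw [map_sub, sub_eq_zero] at this
  exact this.symm

/-- The projection to `𝔮`. -/
def toSub (hd : IsAbelianProjection π 𝔮 d) : Matrix ι ι ℂ →ₗ[ℂ] 𝔮 :=
  LinearMap.codRestrict 𝔮 (LinearMap.id - d) hd.sub_mem

lemma coe_toSub (hd : IsAbelianProjection π 𝔮 d) (X : Matrix ι ι ℂ) :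
    (hd.toSub X : Matrix ι ι ℂ) = X - d X := rfl

lemma toSub_of_mem (hd : IsAbelianProjection π 𝔮 d) {X : Matrix ι ι ℂ} (hX : X ∈ 𝔮) :
    hd.toSub X = ⟨X, hX⟩ := by
  apply Subtype.ext
  rw [coe_toSub, hd.eq_zero X hX, sub_zero]

lemma toSub_map (hd : IsAbelianProjection π 𝔮 d) (X : Matrix ι ι ℂ) :
    hd.toSub (d X) = 0 := by
  apply Subtype.ext
  rw [coe_toSub, hd.map_map, sub_self, Submodule.coe_zero]

/-- The generators of the supersymmetric algebra acting by left multiplication. -/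
def genAct (π : ι → ZMod 2) (𝔮 : Submodule ℂ (Matrix ι ι ℂ)) (V : Type) [AddCommGroup V]
    [Module ℂ V] : Matrix ι ι ℂ →ₗ[ℂ] Module.End ℂ (SuperSym π 𝔮 ⊗[ℂ] V) :=
  (Algebra.lsmul ℂ ℂ (SuperSym π 𝔮 ⊗[ℂ] V)).toLinearMap ∘ₗ SuperSym.gen π 𝔮

lemma genAct_apply (X : Matrix ι ι ℂ) (t : SuperSym π 𝔮 ⊗[ℂ] V) :
    genAct π 𝔮 V X t = SuperSym.gen π 𝔮 X • t := rfl

lemma actStep_eq_zero (hd : IsAbelianProjection π 𝔮 d) {X : Matrix ι ι ℂ} (hX : X ∈ 𝔮) :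
    actStep π d (genAct π 𝔮 V) X = 0 := by
  rw [← part_add_part π X, map_add]
  have h : ∀ b, actStep π d (genAct π 𝔮 V) (part π b X) = 0 := by
    intro b
    ext1 R
    refine linearMap_eq_of_homog π fun c Z hZ => ?_
    rw [actStep_apply d _ hZ (part_mem π b X), hd.eq_zero _ (hd.isGraded X hX b), genAct_apply,
      SuperSym.gen_eq_zero (hd.isGraded X hX b)]
    simp
  rw [h, h, add_zero]

/-- The action of the supersymmetric algebra on linear maps extending `actStep`. -/
def stepHom (hd : IsAbelianProjection π 𝔮 d) (V : Type) [AddCommGroup V] [Module ℂ V] :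
    SuperSym π 𝔮 →ₐ[ℂ] Module.End ℂ (Matrix ι ι ℂ →ₗ[ℂ] SuperSym π 𝔮 ⊗[ℂ] V) :=
  SuperSym.lift (B := Module.End ℂ (Matrix ι ι ℂ →ₗ[ℂ] SuperSym π 𝔮 ⊗[ℂ] V))
    (actStep π d (genAct π 𝔮 V))
    (fun a b X hX Y hY => actStep_comm hd _ (fun a b X hX Y hY => by
      refine LinearMap.ext fun t => ?_
      change SuperSym.gen π 𝔮 X • SuperSym.gen π 𝔮 Y • t =
        sgn a b • SuperSym.gen π 𝔮 Y • SuperSym.gen π 𝔮 X • t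
      rw [← mul_smul, SuperSym.gen_mul_gen hX hY, smul_assoc, mul_smul]) hX hY)
    (fun X hX => hd.actStep_eq_zero hX)

/-- The action of supermatrices on `1 ⊗ V`. -/
def actBase (hd : IsAbelianProjection π 𝔮 d) (M : SuperModule π 𝔮 V) :
    V →ₗ[ℂ] Matrix ι ι ℂ →ₗ[ℂ] SuperSym π 𝔮 ⊗[ℂ] V :=
  LinearMap.mk₂ ℂ (fun v X => SuperSym.gen π 𝔮 X ⊗ₜ[ℂ] v + 1 ⊗ₜ[ℂ] M.act (hd.toSub X) v)
    (fun v v' X => by simp only [TensorProduct.tmul_add, map_add]; abel)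
    (fun c v X => by simp only [TensorProduct.tmul_smul, map_smul, smul_add])
    (fun v X X' => by
      simp only [TensorProduct.add_tmul, TensorProduct.tmul_add, map_add, LinearMap.add_apply]
      abel)
    (fun c v X => by
      simp only [TensorProduct.tmul_smul, TensorProduct.smul_tmul', map_smul, smul_add,
        LinearMap.smul_apply])

/-- The action of all supermatrices on `S ⊗ V`, where `S` is the supersymmetric algebra of the
quotient by `𝔮` and `V` is an `𝔮`-module. -/
def rho (hd : IsAbelianProjection π 𝔮 d) (M : SuperModule π 𝔮 V) :
    Matrix ι ι ℂ →ₗ[ℂ] Module.End ℂ (SuperSym π 𝔮 ⊗[ℂ] V) :=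
  LinearMap.flip (TensorProduct.lift
    (LinearMap.mk₂ ℂ (fun u v => hd.stepHom V u (hd.actBase M v))
      (fun u u' v => by rw [map_add, LinearMap.add_apply])
      (fun c u v => by rw [map_smul, LinearMap.smul_apply])
      (fun u v v' => by rw [map_add, map_add])
      (fun c u v => by rw [map_smul, map_smul])))

lemma rho_tmul (hd : IsAbelianProjection π 𝔮 d) (M : SuperModule π 𝔮 V) (X : Matrix ι ι ℂ)
    (u : SuperSym π 𝔮) (v : V) :
    hd.rho M X (u ⊗ₜ v) = hd.stepHom V u (hd.actBase M v) X := rfl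

lemma rho_one_tmul (hd : IsAbelianProjection π 𝔮 d) (M : SuperModule π 𝔮 V)
    (X : Matrix ι ι ℂ) (v : V) :
    hd.rho M X (1 ⊗ₜ v) = SuperSym.gen π 𝔮 X ⊗ₜ[ℂ] v + 1 ⊗ₜ[ℂ] M.act (hd.toSub X) v := by
  rw [rho_tmul, map_one]
  rfl

lemma rho_gen_smul (hd : IsAbelianProjection π 𝔮 d) (M : SuperModule π 𝔮 V) {c b : ZMod 2}
    {X Y : Matrix ι ι ℂ} (hX : X ∈ homog π c) (hY : Y ∈ homog π b) (t : SuperSym π 𝔮 ⊗[ℂ] V) :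
    hd.rho M X (SuperSym.gen π 𝔮 Y • t) =
      hd.rho M (sbr c b X (d Y)) t + sgn c b • SuperSym.gen π 𝔮 Y • hd.rho M X t := by
  induction t using TensorProduct.induction_on with
  | zero => simp
  | tmul u v =>
    rw [TensorProduct.smul_tmul', smul_eq_mul, rho_tmul, map_mul, Module.End.mul_apply,
      stepHom, SuperSym.lift_gen, actStep_apply d _ hX hY, genAct_apply]
    rfl
  | add x y hx hy =>
    rw [smul_add, map_add, hx, hy, map_add, map_add, smul_add, smul_add]
    abel

/-- The range of `d` is abelian, so the bracket term in `rho_gen_smul` disappears and both sides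
pass a generator `Y` with the same sign. -/
lemma rho_map (hd : IsAbelianProjection π 𝔮 d) (M : SuperModule π 𝔮 V) {c : ZMod 2}
    {Z : Matrix ι ι ℂ} (hZ : Z ∈ homog π c) (t : SuperSym π 𝔮 ⊗[ℂ] V) :
    hd.rho M (d Z) t = SuperSym.gen π 𝔮 Z • t := by
  suffices h : hd.rho M (d Z) = genAct π 𝔮 V Z from LinearMap.congr_fun h t
  refine SuperSym.tensor_linearMap_eq (fun v => ?_) fun b Y hY t ht => ?_
  · rw [rho_one_tmul, toSub_map, map_zero, LinearMap.zero_apply, TensorProduct.tmul_zero, add_zero,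
      genAct_apply, gen_map hd, TensorProduct.smul_tmul', smul_eq_mul, mul_one]
  · rw [rho_gen_smul hd M (hd.homog_mem c Z hZ) hY, ht, genAct_apply, genAct_apply, ← mul_smul,
      ← mul_smul, SuperSym.gen_mul_gen hZ hY, smul_assoc, sbr, hd.mul_eq_zero, hd.mul_eq_zero]
    simp

lemma sbr_jacobi {a b c : ZMod 2} (X Y Z : Matrix ι ι ℂ) :
    sbr a (b + c) X (sbr b c Y Z) + sgn b c • sbr (a + c) b (sbr a c X Z) Y =
      sbr (a + b) c (sbr a b X Y) Z := by
  simp only [sbr, sub_mul, mul_sub, smul_mul_assoc, mul_smul_comm, mul_assoc, smul_sub, smul_smul,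
    sgn_add, sgn_add_right, sgn_comm c b]
  have := sgn_mul_self b c
  rw [show sgn b c * (sgn a b * sgn b c) = sgn a b * (sgn b c * sgn b c) by ring, this, mul_one,
    show sgn b c * (sgn a b * (sgn b c * sgn a c)) = sgn a b * sgn a c * (sgn b c * sgn b c) by
      ring,
    this, mul_one, show sgn a b * (sgn a c * sgn b c) = sgn a c * (sgn b c * sgn a b) by ring,
    show sgn b c * sgn a c = sgn a c * sgn b c by ring]
  abel

/-- The relation `[X, Y] = X Y - (-1)^(|X||Y|) Y X` evaluated at `t`. -/
def BracketAt (hd : IsAbelianProjection π 𝔮 d) (M : SuperModule π 𝔮 V)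
    (t : SuperSym π 𝔮 ⊗[ℂ] V) : Prop :=
  ∀ a b, ∀ X ∈ homog π a, ∀ Y ∈ homog π b,
    hd.rho M (sbr a b X Y) t = hd.rho M X (hd.rho M Y t) - sgn a b • hd.rho M Y (hd.rho M X t)

lemma rho_sbr_map_right (hd : IsAbelianProjection π 𝔮 d) (M : SuperModule π 𝔮 V)
    {a b : ZMod 2} {X Y : Matrix ι ι ℂ} (hX : X ∈ homog π a) (hY : Y ∈ homog π b)
    (t : SuperSym π 𝔮 ⊗[ℂ] V) : hd.rho M (sbr a b X (d Y)) t =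
      hd.rho M X (hd.rho M (d Y) t) - sgn a b • hd.rho M (d Y) (hd.rho M X t) := by
  rw [hd.rho_map M hY, hd.rho_map M hY, hd.rho_gen_smul M hX hY, add_sub_cancel_right]

lemma sbr_swap (a b : ZMod 2) (X Y : Matrix ι ι ℂ) : sbr a b X Y = -(sgn a b • sbr b a Y X) := by
  rw [sbr, sbr, smul_sub, smul_smul, sgn_comm b a, sgn_mul_self, one_smul]
  abel

lemma rho_sbr_map_left (hd : IsAbelianProjection π 𝔮 d) (M : SuperModule π 𝔮 V)
    {a b : ZMod 2} {X Y : Matrix ι ι ℂ} (hX : X ∈ homog π a) (hY : Y ∈ homog π b)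
    (t : SuperSym π 𝔮 ⊗[ℂ] V) : hd.rho M (sbr a b (d X) Y) t =
      hd.rho M (d X) (hd.rho M Y t) - sgn a b • hd.rho M Y (hd.rho M (d X) t) := by
  rw [sbr_swap, map_neg, map_smul, LinearMap.neg_apply, LinearMap.smul_apply,
    hd.rho_sbr_map_right M hY hX, smul_sub, smul_smul, sgn_comm b a, sgn_mul_self, one_smul]
  abel

/-- Splitting `X` and `Y` along `𝔮` and the range of `d` leaves two cases: both arguments in `𝔮`,
where the relation is that of the module `V`, or one argument in the range of `d`, where the rule
for passing a generator is itself the bracket relation. -/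
lemma bracketAt_one_tmul (hd : IsAbelianProjection π 𝔮 d) (M : SuperModule π 𝔮 V) (v : V) :
    hd.BracketAt M (1 ⊗ₜ v) := by
  intro a b X hX Y hY
  have hX' : X - d X ∈ homog π a := Submodule.sub_mem _ hX (hd.homog_mem a X hX)
  have hY' : Y - d Y ∈ homog π b := Submodule.sub_mem _ hY (hd.homog_mem b Y hY)
  have hq : ∀ Z ∈ 𝔮, ∀ v : V, ∃ hZ : Z ∈ 𝔮, hd.rho M Z (1 ⊗ₜ v) = 1 ⊗ₜ M.act ⟨Z, hZ⟩ v := by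
    intro Z hZ v
    refine ⟨hZ, ?_⟩
    rw [rho_one_tmul, SuperSym.gen_eq_zero hZ, TensorProduct.zero_tmul, zero_add,
      hd.toSub_of_mem hZ]
  have e : hd.rho M (sbr a b (X - d X) (Y - d Y)) (1 ⊗ₜ v) =
      hd.rho M (X - d X) (hd.rho M (Y - d Y) (1 ⊗ₜ v)) -
        sgn a b • hd.rho M (Y - d Y) (hd.rho M (X - d X) (1 ⊗ₜ v)) := by
    have hXq := hd.sub_mem X
    have hYq := hd.sub_mem Y
    have hZq : sbr a b (X - d X) (Y - d Y) ∈ 𝔮 :=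
      Submodule.sub_mem _ (hd.mul_mem _ hXq _ hYq)
        (Submodule.smul_mem _ _ (hd.mul_mem _ hYq _ hXq))
    obtain ⟨_, e1⟩ := hq _ hXq v
    obtain ⟨_, e2⟩ := hq _ hYq v
    obtain ⟨_, e3⟩ := hq _ hXq (M.act ⟨_, hYq⟩ v)
    obtain ⟨_, e4⟩ := hq _ hYq (M.act ⟨_, hXq⟩ v)
    obtain ⟨_, e5⟩ := hq _ hZq v
    rw [e1, e2, e3, e4, e5, M.act_bracket a b ⟨_, hXq⟩ ⟨_, hYq⟩ ⟨_, hZq⟩ hX' hY' rfl,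
      TensorProduct.tmul_sub, TensorProduct.tmul_smul]
  have e1 := hd.rho_sbr_map_right M hX' hY (1 ⊗ₜ[ℂ] v)
  have e2 := hd.rho_sbr_map_left M hX hY (1 ⊗ₜ[ℂ] v)
  have m : sbr a b X Y = sbr a b (X - d X) (Y - d Y) + sbr a b (X - d X) (d Y) +
      sbr a b (d X) Y := by
    simp only [sbr, sub_mul, mul_sub, smul_sub]
    abel
  rw [m, map_add, map_add, LinearMap.add_apply, LinearMap.add_apply, e, e1, e2]
  simp only [map_sub, LinearMap.sub_apply, smul_sub]
  abel

/-- The relation propagates from `t` to `Z t` by the super Jacobi identity, starting from `1 ⊗ V`.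
-/
lemma bracketAt (hd : IsAbelianProjection π 𝔮 d) (M : SuperModule π 𝔮 V)
    (t : SuperSym π 𝔮 ⊗[ℂ] V) : hd.BracketAt M t := by
  let P : Submodule ℂ (SuperSym π 𝔮 ⊗[ℂ] V) :=
    { carrier := {t | hd.BracketAt M t}
      zero_mem' := fun a b X hX Y hY => by simp
      add_mem' := fun {s t} hs ht a b X hX Y hY => by
        simp only [map_add, hs a b X hX Y hY, ht a b X hX Y hY, smul_add]
        abel
      smul_mem' := fun r t ht a b X hX Y hY => by
        simp only [map_smul, ht a b X hX Y hY, smul_sub, smul_comm r] }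
  have hP : P = ⊤ := by
    refine SuperSym.tensor_eq_top P (hd.bracketAt_one_tmul M) fun c Z hZ t ht => ?_
    intro a b X hX Y hY
    have hz := hd.homog_mem c Z hZ
    -- The relation at `t` is needed for the pairs `X, [Y, dZ]` and `[X, dZ], Y`, the two terms of
    -- the Jacobi expansion of `[[X, Y], dZ]`.
    have j1 := ht a (b + c) X hX _ (sbr_mem hY hz)
    have j2 := ht (a + c) b _ (sbr_mem hX hz) Y hY
    have hs : ∀ (r : ℂ) (t : SuperSym π 𝔮 ⊗[ℂ] V),
        SuperSym.gen π 𝔮 Z • r • t = r • SuperSym.gen π 𝔮 Z • t := fun r t => smul_comm _ _ _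
    rw [hd.rho_gen_smul M (sbr_mem hX hY) hZ, hd.rho_gen_smul M hX hZ, hd.rho_gen_smul M hY hZ,
      ← sbr_jacobi, (hd.rho M).map_add, LinearMap.add_apply, (hd.rho M).map_smul,
      LinearMap.smul_apply, j1, j2, ht a b X hX Y hY, (hd.rho M X).map_add, (hd.rho M Y).map_add,
      (hd.rho M X).map_smul, (hd.rho M Y).map_smul, hd.rho_gen_smul M hX hZ,
      hd.rho_gen_smul M hY hZ]
    simp only [smul_add, smul_sub, smul_smul, sgn_add, sgn_add_right, sgn_comm c b, hs]
    have := sgn_mul_self b c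
    rw [show sgn b c * (sgn a b * sgn b c) = sgn a b * (sgn b c * sgn b c) by ring,
      this, mul_one,
      show sgn a c * sgn b c * sgn a b = sgn a b * (sgn a c * sgn b c) by ring,
      show sgn b c * sgn a c = sgn a c * sgn b c by ring]
    abel
  exact (hP ▸ Submodule.mem_top : t ∈ P)

/-- The action of the enveloping superalgebra on `S ⊗ V`. -/
def rhoU (hd : IsAbelianProjection π 𝔮 d) (M : SuperModule π 𝔮 V) :
    U π →ₐ[ℂ] Module.End ℂ (SuperSym π 𝔮 ⊗[ℂ] V) :=
  RingQuot.liftAlgHom ℂ ⟨TensorAlgebra.lift ℂ (hd.rho M), by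
    rintro _ _ ⟨a, b, X, Y, hX, hY⟩
    simp only [map_sub (TensorAlgebra.lift ℂ _), map_smul, map_mul, TensorAlgebra.lift_ι_apply]
    refine LinearMap.ext fun t => ?_
    exact (hd.bracketAt M t a b X hX Y hY).symm⟩

lemma rhoU_of (hd : IsAbelianProjection π 𝔮 d) (M : SuperModule π 𝔮 V) (X : Matrix ι ι ℂ) :
    hd.rhoU M (U.of π X) = hd.rho M X := by
  refine (RingQuot.liftAlgHom_mkAlgHom_apply ℂ _ _ _).trans ?_
  rw [TensorAlgebra.lift_ι_apply]

end IsAbelianProjection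

end SuperPair

namespace SuperPair

/-! ### Embedding the induced module into `S ⊗ V` -/

section Enveloping

variable {ι : Type} [Fintype ι] {π : ι → ZMod 2}

lemma U.induction {C : U π → Prop} (algebraMap : ∀ r, C (algebraMap ℂ (U π) r))
    (of : ∀ X, C (U.of π X)) (mul : ∀ a b, C a → C b → C (a * b))
    (add : ∀ a b, C a → C b → C (a + b)) (u : U π) : C u := by
  obtain ⟨u, rfl⟩ : ∃ x, U.mk π x = u := RingQuot.mkAlgHom_surjective ℂ (Rel π) u
  induction u using TensorAlgebra.induction with
  | algebraMap r => rw [AlgHom.commutes]; exact algebraMap r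
  | ι X => exact of X
  | mul x y hx hy => rw [map_mul]; exact mul _ _ hx hy
  | add x y hx hy => rw [map_add]; exact add _ _ hx hy

/-- A subspace stable under all homogeneous supermatrices is stable under the enveloping
superalgebra. -/
lemma U.smul_mem_of_forall {V : Type*} [AddCommGroup V] [Module ℂ V] [Module (U π) V]
    [IsScalarTower ℂ (U π) V] (P : Submodule ℂ V)
    (h : ∀ a, ∀ X ∈ homog π a, ∀ v ∈ P, U.of π X • v ∈ P) (u : U π) :
    ∀ v ∈ P, u • v ∈ P := by
  induction u using U.induction with
  | algebraMap r => intro v hv; rw [algebraMap_smul]; exact P.smul_mem r hv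
  | of X =>
    intro v hv
    rw [← part_add_part π X, map_add, add_smul]
    exact P.add_mem (h 0 _ (part_mem π 0 X) v hv) (h 1 _ (part_mem π 1 X) v hv)
  | mul x y hx hy => intro v hv; rw [mul_smul]; exact hx _ (hy v hv)
  | add x y hx hy => intro v hv; rw [add_smul]; exact P.add_mem (hx v hv) (hy v hv)

end Enveloping

namespace IsAbelianProjection

variable {ι : Type} [Fintype ι] {π : ι → ZMod 2} {𝔮 : Submodule ℂ (Matrix ι ι ℂ)}
  {d : Matrix ι ι ℂ →ₗ[ℂ] Matrix ι ι ℂ} {V : Type} [AddCommGroup V] [Module ℂ V]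

/-- The map `u ⊗ v ↦ u (1 ⊗ v)`. -/
def toTensorAux (hd : IsAbelianProjection π 𝔮 d) (M : SuperModule π 𝔮 V) :
    U π ⊗[ℂ] V →ₗ[ℂ] SuperSym π 𝔮 ⊗[ℂ] V :=
  TensorProduct.lift (LinearMap.mk₂ ℂ (fun u v => hd.rhoU M u (1 ⊗ₜ v))
    (fun u u' v => by rw [map_add, LinearMap.add_apply])
    (fun c u v => by rw [map_smul, LinearMap.smul_apply])
    (fun u v v' => by rw [TensorProduct.tmul_add, map_add])
    (fun c u v => by rw [TensorProduct.tmul_smul, map_smul]))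

lemma toTensorAux_tmul (hd : IsAbelianProjection π 𝔮 d) (M : SuperModule π 𝔮 V) (u : U π)
    (v : V) : hd.toTensorAux M (u ⊗ₜ v) = hd.rhoU M u (1 ⊗ₜ v) := rfl

lemma toTensorAux_smul (hd : IsAbelianProjection π 𝔮 d) (M : SuperModule π 𝔮 V) (u : U π)
    (z : U π ⊗[ℂ] V) : hd.toTensorAux M (u • z) = hd.rhoU M u (hd.toTensorAux M z) := by
  induction z using TensorProduct.induction_on with
  | zero => simp
  | tmul x v =>
    rw [TensorProduct.smul_tmul', smul_eq_mul, toTensorAux_tmul, map_mul, Module.End.mul_apply,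
      toTensorAux_tmul]
  | add x y hx hy => rw [smul_add, map_add, hx, hy, map_add, map_add]

/-- The kernel is a `U π`-submodule by equivariance, so only the generators of `M.balanced` matter;
on these, `𝔮` acts on `1 ⊗ V` through `V`. -/
lemma balanced_le_ker (hd : IsAbelianProjection π 𝔮 d) (M : SuperModule π 𝔮 V) :
    M.balanced.restrictScalars ℂ ≤ LinearMap.ker (hd.toTensorAux M) := by
  let K : Submodule (U π) (U π ⊗[ℂ] V) :=
    { carrier := {z | hd.toTensorAux M z = 0}
      zero_mem' := map_zero _
      add_mem' := fun {x y} hx hy => by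
        change hd.toTensorAux M x = 0 at hx
        change hd.toTensorAux M y = 0 at hy
        change hd.toTensorAux M (x + y) = 0
        rw [map_add, hx, hy, add_zero]
      smul_mem' := fun u z hz => by
        change hd.toTensorAux M z = 0 at hz
        change hd.toTensorAux M (u • z) = 0
        rw [toTensorAux_smul, hz, map_zero] }
  have : M.balanced ≤ K := by
    refine Submodule.span_le.2 ?_
    rintro _ ⟨u, X, v, rfl⟩
    change hd.toTensorAux M _ = 0
    rw [map_sub, toTensorAux_tmul, toTensorAux_tmul, map_mul, rhoU_of, Module.End.mul_apply,
      rho_one_tmul, SuperSym.gen_eq_zero X.2, hd.toSub_of_mem X.2, TensorProduct.zero_tmul,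
      zero_add, sub_self]
  exact this

/-- The map from the induced module to `S ⊗ V`. -/
def toTensor (hd : IsAbelianProjection π 𝔮 d) (M : SuperModule π 𝔮 V) :
    M.IndSpace →ₗ[ℂ] SuperSym π 𝔮 ⊗[ℂ] V :=
  (M.balanced.restrictScalars ℂ).liftQ (hd.toTensorAux M) (hd.balanced_le_ker M) ∘ₗ
    (Submodule.Quotient.restrictScalarsEquiv ℂ M.balanced).symm.toLinearMap

lemma toTensor_mk (hd : IsAbelianProjection π 𝔮 d) (M : SuperModule π 𝔮 V) (z : U π ⊗[ℂ] V) :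
    hd.toTensor M (Submodule.Quotient.mk z) = hd.toTensorAux M z := rfl

lemma toTensor_smul (hd : IsAbelianProjection π 𝔮 d) (M : SuperModule π 𝔮 V) (u : U π)
    (z : M.IndSpace) : hd.toTensor M (u • z) = hd.rhoU M u (hd.toTensor M z) := by
  induction z using Submodule.Quotient.induction_on with
  | H z => rw [← Submodule.Quotient.mk_smul, toTensor_mk, toTensor_mk, toTensorAux_smul]

/-- The map from the supersymmetric algebra to the enveloping superalgebra given by `d`. -/
def symToU (hd : IsAbelianProjection π 𝔮 d) : SuperSym π 𝔮 →ₐ[ℂ] U π :=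
  SuperSym.lift (U.of π ∘ₗ d)
    (fun a b X hX Y hY => by
      have := U.of_bracket (hd.homog_mem a X hX) (hd.homog_mem b Y hY)
      rw [hd.mul_eq_zero, hd.mul_eq_zero, smul_zero, sub_zero, map_zero, sub_eq_zero] at this
      exact this)
    (fun X hX => by rw [LinearMap.comp_apply, hd.eq_zero X hX, map_zero])

lemma symToU_gen (hd : IsAbelianProjection π 𝔮 d) (X : Matrix ι ι ℂ) :
    hd.symToU (SuperSym.gen π 𝔮 X) = U.of π (d X) :=
  SuperSym.lift_gen _ _ _ _

/-- The map from `S ⊗ V` to the induced module. -/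
def ofTensor (hd : IsAbelianProjection π 𝔮 d) (M : SuperModule π 𝔮 V) :
    SuperSym π 𝔮 ⊗[ℂ] V →ₗ[ℂ] M.IndSpace :=
  (M.balanced.mkQ).restrictScalars ℂ ∘ₗ TensorProduct.map hd.symToU.toLinearMap LinearMap.id

lemma ofTensor_tmul (hd : IsAbelianProjection π 𝔮 d) (M : SuperModule π 𝔮 V)
    (x : SuperSym π 𝔮) (v : V) :
    hd.ofTensor M (x ⊗ₜ v) = Submodule.Quotient.mk (hd.symToU x ⊗ₜ v) := rfl

lemma ofTensor_gen_smul (hd : IsAbelianProjection π 𝔮 d) (M : SuperModule π 𝔮 V)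
    (X : Matrix ι ι ℂ) (t : SuperSym π 𝔮 ⊗[ℂ] V) :
    hd.ofTensor M (SuperSym.gen π 𝔮 X • t) = U.of π (d X) • hd.ofTensor M t := by
  induction t using TensorProduct.induction_on with
  | zero => simp
  | tmul x v =>
    rw [TensorProduct.smul_tmul', smul_eq_mul, ofTensor_tmul, map_mul, symToU_gen,
      ofTensor_tmul, ← Submodule.Quotient.mk_smul, TensorProduct.smul_tmul', smul_eq_mul]
  | add x y hx hy => rw [smul_add, map_add, hx, hy, map_add, smul_add]

/-- On `1 ⊗ v` this is the balancing relation for the `𝔮`-component of `X`; afterwards both sides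
obey the same commutation rule with generators. -/
lemma ofTensor_rho (hd : IsAbelianProjection π 𝔮 d) (M : SuperModule π 𝔮 V)
    (X : Matrix ι ι ℂ) (t : SuperSym π 𝔮 ⊗[ℂ] V) :
    hd.ofTensor M (hd.rho M X t) = U.of π X • hd.ofTensor M t := by
  let P : Submodule ℂ (SuperSym π 𝔮 ⊗[ℂ] V) :=
    { carrier := {t | ∀ a, ∀ X ∈ homog π a,
        hd.ofTensor M (hd.rho M X t) = U.of π X • hd.ofTensor M t}
      zero_mem' := fun a X hX => by simp
      add_mem' := fun {s t} hs ht a X hX => by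
        rw [map_add, map_add, hs a X hX, ht a X hX, map_add, smul_add]
      smul_mem' := fun r t ht a X hX => by
        rw [map_smul, map_smul, ht a X hX, map_smul, smul_comm] }
  have hP : P = ⊤ := by
    refine SuperSym.tensor_eq_top P (fun v a X hX => ?_) fun b Y hY t ht a X hX => ?_
    · have e : (Submodule.Quotient.mk ((1 * U.of π (hd.toSub X : Matrix ι ι ℂ)) ⊗ₜ[ℂ] v) :
          M.IndSpace) = Submodule.Quotient.mk (1 ⊗ₜ[ℂ] M.act (hd.toSub X) v) :=
        (Submodule.Quotient.eq _).2 (Submodule.subset_span ⟨1, hd.toSub X, v, rfl⟩)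
      rw [one_mul] at e
      rw [rho_one_tmul, map_add, ofTensor_tmul, ofTensor_tmul, ofTensor_tmul, symToU_gen, map_one,
        ← e, ← Submodule.Quotient.mk_add, ← TensorProduct.add_tmul, ← map_add, coe_toSub,
        add_sub_cancel, ← Submodule.Quotient.mk_smul, TensorProduct.smul_tmul', smul_eq_mul,
        mul_one]
    · have hy := hd.homog_mem b Y hY
      rw [hd.rho_gen_smul M hX hY, map_add, map_smul, ofTensor_gen_smul, ofTensor_gen_smul,
        ht _ _ (sbr_mem hX hy), ht a X hX, sbr, ← U.of_bracket hX hy, sub_smul, smul_assoc,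
        mul_smul, mul_smul, sub_add_cancel]
  have ht : t ∈ P := hP ▸ Submodule.mem_top
  rw [← part_add_part π X, map_add, LinearMap.add_apply, map_add, ht 0 _ (part_mem π 0 X),
    ht 1 _ (part_mem π 1 X), map_add, add_smul]

lemma ofTensor_rhoU (hd : IsAbelianProjection π 𝔮 d) (M : SuperModule π 𝔮 V) (u : U π) :
    ∀ t, hd.ofTensor M (hd.rhoU M u t) = u • hd.ofTensor M t := by
  induction u using U.induction with
  | algebraMap r =>
    intro t
    rw [AlgHom.commutes, Module.algebraMap_end_apply, map_smul, algebraMap_smul]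
  | of X => intro t; rw [rhoU_of, ofTensor_rho]
  | mul x y hx hy => intro t; rw [map_mul, Module.End.mul_apply, hx, hy, mul_smul]
  | add x y hx hy => intro t; rw [map_add, LinearMap.add_apply, map_add, hx, hy, add_smul]

/-- By equivariance it is enough to look at `1 ⊗ v`. This one-sided inverse already gives
injectivity of `toTensor`, which is all that is used of the isomorphism. -/
lemma ofTensor_toTensor (hd : IsAbelianProjection π 𝔮 d) (M : SuperModule π 𝔮 V)
    (z : M.IndSpace) : hd.ofTensor M (hd.toTensor M z) = z := by
  induction z using Submodule.Quotient.induction_on with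
  | H z =>
    rw [toTensor_mk]
    induction z using TensorProduct.induction_on with
    | zero => simp
    | tmul u v =>
      rw [toTensorAux_tmul, ofTensor_rhoU, ofTensor_tmul, map_one, ← Submodule.Quotient.mk_smul,
        TensorProduct.smul_tmul', smul_eq_mul, mul_one]
    | add x y hx hy => rw [map_add, map_add, hx, hy, Submodule.Quotient.mk_add]

/-- The induced module embeds into `S ⊗ V`. -/
lemma toTensor_injective (hd : IsAbelianProjection π 𝔮 d) (M : SuperModule π 𝔮 V) :
    Function.Injective (hd.toTensor M) :=
  Function.LeftInverse.injective (hd.ofTensor_toTensor M)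

lemma toTensor_of_smul (hd : IsAbelianProjection π 𝔮 d) (M : SuperModule π 𝔮 V)
    (X : Matrix ι ι ℂ) (z : M.IndSpace) :
    hd.toTensor M (U.of π X • z) = hd.rho M X (hd.toTensor M z) := by
  rw [toTensor_smul, rhoU_of]

end IsAbelianProjection

end SuperPair

namespace SuperPair

/-! ### Eigenspaces for eigenvalues in an arithmetic progression -/

section Eigen

variable {V : Type*} [AddCommGroup V] [Module ℂ V]

/-- The sum of the eigenspaces for the eigenvalues `y, y + 1, y + 2, …`. -/
def natEig (T : Module.End ℂ V) (y : ℂ) : Submodule ℂ V := ⨆ n : ℕ, T.eigenspace (y + n)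

lemma mem_natEig_of_eq {T : Module.End ℂ V} {y x : ℂ} {v : V} (n : ℕ) (hx : x = y + n)
    (hv : T v = x • v) : v ∈ natEig T y :=
  Submodule.mem_iSup_of_mem n (Module.End.mem_eigenspace_iff.2 (hx ▸ hv))

lemma natEig_le {T : Module.End ℂ V} {y : ℂ} {P : Submodule ℂ V}
    (h : ∀ n : ℕ, ∀ v, T v = (y + n) • v → v ∈ P) : natEig T y ≤ P :=
  iSup_le fun n _ hv => h n _ (Module.End.mem_eigenspace_iff.1 hv)

lemma exists_of_mem_natEig {T : Module.End ℂ V} {y : ℂ} {v : V} (hv : v ∈ natEig T y) :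
    ∃ f : ℕ →₀ V, (∀ n, T (f n) = (y + n) • f n) ∧ ∑ n ∈ f.support, f n = v := by
  obtain ⟨f, hf, h⟩ := (Submodule.mem_iSup_iff_exists_finsupp _ _).1 hv
  exact ⟨f, fun n => Module.End.mem_eigenspace_iff.1 (hf n), h⟩

/-- Eigenspaces are independent, so an eigenvalue outside the progression would force `v = 0`. This
is how integrality and positivity are extracted later. -/
lemma exists_nat_of_mem_natEig {T : Module.End ℂ V} {x y : ℂ} {v : V} (hx : T v = x • v)
    (hv : v ∈ natEig T y) (h0 : v ≠ 0) : ∃ n : ℕ, x = y + n := by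
  by_contra! h
  refine h0 (Submodule.disjoint_def.1 (Module.End.eigenspaces_iSupIndep T x) v
    (Module.End.mem_eigenspace_iff.2 hx) ?_)
  exact (iSup_le fun n => le_iSup₂_of_le (y + n) (h n).symm le_rfl : natEig T y ≤ _) hv

lemma eq_zero_of_sum_eigen_eq_zero {T : Module.End ℂ V} {y : ℂ} {s : Finset ℕ} {g : ℕ → V}
    (hg : ∀ n, T (g n) = (y + n) • g n) (hs : ∑ n ∈ s, g n = 0) : ∀ n ∈ s, g n = 0 := by
  have h : iSupIndep fun n : ℕ => T.eigenspace (y + n) :=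
    (Module.End.eigenspaces_iSupIndep T).comp fun m n h => by
      have : (m : ℂ) = n := add_left_cancel h
      exact_mod_cast this
  exact (iSupIndep_iff_finsetSum_eq_zero_imp_eq_zero _).1 h s g
    (fun n _ => Module.End.mem_eigenspace_iff.2 (hg n)) hs

end Eigen

/-! ### Singular vectors of irreducible highest weight modules -/

section Singular

variable {p q : ℕ}

/-- The position of a basis index in the order `ε₁ … ε_p δ₁ … δ_q`. -/
def ht : Fin p ⊕ Fin q → ℕ := Sum.elim (fun i => i) (fun j => p + j)

lemma lex_iff_ht_lt (i j : Fin p ⊕ Fin q) : Sum.Lex (· < ·) (· < ·) i j ↔ ht i < ht j := by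
  rcases i with i | i <;> rcases j with j | j <;> simp [ht] <;> omega

lemma ht_injective : Function.Injective (ht (p := p) (q := q)) := by
  rintro (i | i) (j | j) h <;> simp [ht] at h ⊢ <;> omega

lemma diagonal_mem_homog {ι : Type} [Fintype ι] [DecidableEq ι] (π : ι → ZMod 2) (c : ι → ℂ) :
    Matrix.diagonal c ∈ homog π 0 := by
  intro i j h
  have h2 : ∀ x : ZMod 2, x + x = 0 := by decide
  exact Matrix.diagonal_apply_ne _ fun e => h (e ▸ h2 _)

variable {V : Type*} [AddCommGroup V] [Module ℂ V] [Module (U (parity p q)) V]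
  [IsScalarTower ℂ (U (parity p q)) V]

/-- The action of a supermatrix as an endomorphism. -/
def uAct (V : Type*) [AddCommGroup V] [Module ℂ V] [Module (U (parity p q)) V]
    [IsScalarTower ℂ (U (parity p q)) V] :
    Matrix (Fin p ⊕ Fin q) (Fin p ⊕ Fin q) ℂ →ₗ[ℂ] Module.End ℂ V :=
  (Algebra.lsmul ℂ ℂ V).toLinearMap ∘ₗ U.of (parity p q)

lemma uAct_apply (X : Matrix (Fin p ⊕ Fin q) (Fin p ⊕ Fin q) ℂ) (v : V) :
    uAct V X v = U.of (parity p q) X • v := rfl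

lemma uAct_sbr {a b : ZMod 2} {X Y : Matrix (Fin p ⊕ Fin q) (Fin p ⊕ Fin q) ℂ}
    (hX : X ∈ homog (parity p q) a) (hY : Y ∈ homog (parity p q) b) (v : V) :
    uAct V X (uAct V Y v) = uAct V (sbr a b X Y) v + sgn a b • uAct V Y (uAct V X v) := by
  simp only [uAct_apply, sbr, ← U.of_bracket hX hY, sub_smul, smul_assoc, mul_smul]
  abel

lemma uAct_mem_of_single (P : Submodule ℂ V) {v : V}
    (h : ∀ i j : Fin p ⊕ Fin q, uAct V (Matrix.single i j 1) v ∈ P)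
    (X : Matrix (Fin p ⊕ Fin q) (Fin p ⊕ Fin q) ℂ) : uAct V X v ∈ P := by
  rw [Matrix.matrix_eq_sum_single X, map_sum, LinearMap.sum_apply]
  refine P.sum_mem fun i _ => ?_
  rw [map_sum, LinearMap.sum_apply]
  refine P.sum_mem fun j _ => ?_
  rw [show Matrix.single i j (X i j) = X i j • Matrix.single i j (1 : ℂ) by
    rw [Matrix.smul_single, smul_eq_mul, mul_one], map_smul]
  exact P.smul_mem _ (h i j)

/-- The diagonal supermatrix measuring heights of weights. -/
def htMatrix (p q : ℕ) : Matrix (Fin p ⊕ Fin q) (Fin p ⊕ Fin q) ℂ :=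
  Matrix.diagonal fun i => (ht i : ℂ)

lemma diagonal_bracket_single {ι : Type} [Fintype ι] [DecidableEq ι] (c : ι → ℂ) (i j : ι) :
    Matrix.diagonal c * Matrix.single i j 1 - Matrix.single i j 1 * Matrix.diagonal c =
      (c i - c j) • Matrix.single i j (1 : ℂ) := by
  ext k l
  rw [Matrix.sub_apply, Matrix.diagonal_mul, Matrix.mul_diagonal, Matrix.smul_apply,
    Matrix.single_apply, smul_eq_mul]
  split_ifs with h
  · rw [← h.1, ← h.2]; ring
  · ring

lemma htMatrix_uAct_single (i j : Fin p ⊕ Fin q) {y : ℂ} {v : V}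
    (hv : uAct V (htMatrix p q) v = y • v) :
    uAct V (htMatrix p q) (uAct V (Matrix.single i j 1) v) =
      (y + (ht i - ht j)) • uAct V (Matrix.single i j 1) v := by
  rw [htMatrix, uAct_sbr (diagonal_mem_homog _ _) (single_mem_homog i j), sbr, sgn_zero_left,
    one_smul, diagonal_bracket_single, ← htMatrix, hv, map_smul, map_smul, one_smul, add_smul,
    LinearMap.smul_apply, add_comm]

/-- With this choice of `htMatrix`, heights grow under lowering operators: `E_ij` shifts the
eigenvalue by `ht i - ht j ≥ 1`. -/
lemma uAct_single_mem_natEig {i j : Fin p ⊕ Fin q} (hij : ht j < ht i) {y : ℂ} {v : V}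
    (hv : v ∈ natEig (uAct V (htMatrix p q)) y) :
    uAct V (Matrix.single i j 1) v ∈ natEig (uAct V (htMatrix p q)) (y + 1) := by
  suffices h : natEig (uAct V (htMatrix p q)) y ≤
      (natEig (uAct V (htMatrix p q)) (y + 1)).comap (uAct V (Matrix.single i j 1)) from h hv
  refine natEig_le fun n v hv => ?_
  obtain ⟨m, hm⟩ := Nat.exists_eq_add_of_lt hij
  refine mem_natEig_of_eq (n + m) ?_ (htMatrix_uAct_single i j hv)
  rw [hm]
  push_cast
  ring

/-- A subspace stable under lowering operators which contains a generating set stable under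
upper triangular matrix units contains the submodule generated by this set. -/
lemma smul_mem_of_lowering_stable (K P : Submodule ℂ V) (hKP : K ≤ P)
    (hup : ∀ i j : Fin p ⊕ Fin q, ht i ≤ ht j → ∀ v ∈ K, uAct V (Matrix.single i j 1) v ∈ K)
    (hP : ∀ i j : Fin p ⊕ Fin q, ht j < ht i → ∀ v ∈ P, uAct V (Matrix.single i j 1) v ∈ P)
    (u : U (parity p q)) {v : V} (hv : v ∈ K) : u • v ∈ P := by
  -- The smallest lowering-stable subspace containing `K` turns out to be stable under everything,
  -- which takes the place of a triangular decomposition of the enveloping algebra.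
  let C : Set (Submodule ℂ V) := {P | K ≤ P ∧ ∀ i j : Fin p ⊕ Fin q, ht j < ht i →
    ∀ v ∈ P, uAct V (Matrix.single i j 1) v ∈ P}
  have hC : sInf C ∈ C := ⟨le_sInf fun P hP => hP.1, fun i j hij v hv =>
    Submodule.mem_sInf.2 fun P hP => hP.2 i j hij v (Submodule.mem_sInf.1 hv P hP)⟩
  -- The vectors whose images under all supermatrices stay in the smallest subspace. Moving `X` past
  -- a lowering operator costs only a bracket, again a supermatrix, so `Q` is lowering-stable;
  -- minimality then gives stability.
  let Q : Submodule ℂ V :=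
    { carrier := {t | t ∈ sInf C ∧ ∀ a, ∀ X ∈ homog (parity p q) a, uAct V X t ∈ sInf C}
      zero_mem' := ⟨Submodule.zero_mem _, fun a X hX => by
        rw [map_zero]; exact Submodule.zero_mem _⟩
      add_mem' := fun {s t} hs ht => ⟨Submodule.add_mem _ hs.1 ht.1, fun a X hX => by
        rw [map_add]; exact Submodule.add_mem _ (hs.2 a X hX) (ht.2 a X hX)⟩
      smul_mem' := fun r t ht => ⟨Submodule.smul_mem _ _ ht.1, fun a X hX => by
        rw [map_smul]; exact Submodule.smul_mem _ _ (ht.2 a X hX)⟩ }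
  have hQ : Q ∈ C := by
    refine ⟨fun v hv => ⟨hC.1 hv, fun a X _ => uAct_mem_of_single _ (fun i j => ?_) X⟩,
      fun i j hij t ht => ⟨hC.2 i j hij t ht.1, fun a X hX => ?_⟩⟩
    · rcases lt_or_ge (ht j) (ht i) with h | h
      · exact hC.2 i j h v (hC.1 hv)
      · exact hC.1 (hup i j h v hv)
    · rw [uAct_sbr hX (single_mem_homog i j)]
      exact Submodule.add_mem _ (ht.2 _ _ (sbr_mem hX (single_mem_homog i j)))
        (Submodule.smul_mem _ _ (hC.2 i j hij _ (ht.2 a X hX)))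
  have key := U.smul_mem_of_forall (sInf C)
    (fun a X hX v hv => ((Submodule.mem_sInf.1 hv Q hQ).2 a X hX)) u v (hC.1 hv)
  exact Submodule.mem_sInf.1 key P ⟨hKP, hP⟩

/-- The submodule generated by singular vectors of height `y` has only larger heights apart from
the singular vectors themselves. -/
lemma smul_mem_sup_natEig (K : Submodule ℂ V) (y : ℂ)
    (hK : ∀ v ∈ K, uAct V (htMatrix p q) v = y • v)
    (hup : ∀ i j : Fin p ⊕ Fin q, ht i ≤ ht j → ∀ v ∈ K, uAct V (Matrix.single i j 1) v ∈ K)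
    (u : U (parity p q)) {v : V} (hv : v ∈ K) :
    u • v ∈ K ⊔ natEig (uAct V (htMatrix p q)) (y + 1) := by
  refine smul_mem_of_lowering_stable K _ le_sup_left hup (fun i j hij t ht => ?_) u hv
  have hle : K ⊔ natEig (uAct V (htMatrix p q)) (y + 1) ≤ natEig (uAct V (htMatrix p q)) y :=
    sup_le (fun v hv => mem_natEig_of_eq 0 (by simp) (hK v hv))
      (natEig_le fun n v hv => mem_natEig_of_eq (n + 1) (by push_cast; ring) hv)
  exact Submodule.mem_sup_right (uAct_single_mem_natEig hij (hle ht))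

/-- The highest weight vector of `L(κ)`. -/
def hwVec (κ : Fin p ⊕ Fin q → ℂ) : LSpace κ :=
  Submodule.Quotient.mk (Submodule.Quotient.mk 1)

lemma mk_eq_smul_hwVec (κ : Fin p ⊕ Fin q → ℂ) (u : U (parity p q)) :
    (Submodule.Quotient.mk (Submodule.Quotient.mk u) : LSpace κ) = u • hwVec κ := by
  rw [hwVec, ← Submodule.Quotient.mk_smul, ← Submodule.Quotient.mk_smul, smul_eq_mul, mul_one]

lemma exists_smul_hwVec (κ : Fin p ⊕ Fin q → ℂ) (v : LSpace κ) :
    ∃ u : U (parity p q), v = u • hwVec κ := by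
  induction v using Submodule.Quotient.induction_on with
  | H v =>
    induction v using Submodule.Quotient.induction_on with
    | H u => exact ⟨u, mk_eq_smul_hwVec κ u⟩

lemma raising_hwVec (κ : Fin p ⊕ Fin q → ℂ) {i j : Fin p ⊕ Fin q} (hij : ht i < ht j) :
    uAct (LSpace κ) (Matrix.single i j 1) (hwVec κ) = 0 := by
  rw [uAct_apply, ← mk_eq_smul_hwVec]
  have : (Submodule.Quotient.mk (U.of (parity p q) (Matrix.single i j 1)) : Verma κ) = 0 :=
    (Submodule.Quotient.mk_eq_zero _).2
      (Submodule.subset_span (Or.inl ⟨i, j, (lex_iff_ht_lt i j).2 hij, rfl⟩))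
  rw [this, Submodule.Quotient.mk_zero]

lemma diag_hwVec (κ : Fin p ⊕ Fin q → ℂ) (i : Fin p ⊕ Fin q) :
    uAct (LSpace κ) (Matrix.single i i 1) (hwVec κ) = κ i • hwVec κ := by
  rw [uAct_apply, ← algebraMap_smul (U (parity p q)) (κ i), ← mk_eq_smul_hwVec,
    ← mk_eq_smul_hwVec]
  exact congrArg _ ((Submodule.Quotient.eq _).2 (Submodule.subset_span (Or.inr ⟨i, rfl⟩)))

lemma htMatrix_hwVec (κ : Fin p ⊕ Fin q → ℂ) :
    uAct (LSpace κ) (htMatrix p q) (hwVec κ) = (∑ i, ht i * κ i) • hwVec κ := by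
  have : htMatrix p q = ∑ i, (ht i : ℂ) • Matrix.single i i (1 : ℂ) := by
    ext k l
    simp only [htMatrix, Matrix.sum_apply, Matrix.smul_apply, Matrix.single_apply,
      Matrix.diagonal_apply, smul_eq_mul]
    by_cases h : k = l
    · subst h; simp
    · rw [if_neg h, Finset.sum_eq_zero fun i _ => ?_]
      rw [if_neg fun e => h (e.1.symm.trans e.2), mul_zero]
  simp only [this, map_sum, map_smul, LinearMap.sum_apply, LinearMap.smul_apply, diag_hwVec,
    Finset.sum_smul, smul_smul]

/-- `L(κ)` is generated by each of its nonzero vectors. -/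
lemma exists_smul_eq_of_ne_zero (κ : Fin p ⊕ Fin q → ℂ) {v : LSpace κ} (hv : v ≠ 0)
    (w : LSpace κ) : ∃ u : U (parity p q), u • v = w := by
  by_cases h : Submodule.span (U (parity p q)) {v} = ⊤
  · exact Submodule.mem_span_singleton.1 (h ▸ Submodule.mem_top)
  · exfalso
    apply hv
    obtain ⟨v', rfl⟩ := Submodule.Quotient.mk_surjective _ v
    rw [Submodule.Quotient.mk_eq_zero]
    -- The preimage in the Verma module of a proper submodule is proper, hence inside the radical,
    -- so `v` vanishes in the quotient.
    have hN : (Submodule.span (U (parity p q)) {(Submodule.Quotient.mk v' : LSpace κ)}).comap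
        (vermaRadical κ).mkQ ≠ ⊤ := by
      intro e
      apply h
      rw [eq_top_iff, ← Submodule.range_mkQ (vermaRadical κ), LinearMap.range_eq_map, ← e]
      exact Submodule.map_comap_le _ _
    exact (le_sSup hN : _ ≤ vermaRadical κ)
      (Submodule.mem_comap.2 (Submodule.mem_span_singleton_self _))

/-- The multiples of the highest weight vector are the vectors of `L(κ)` of minimal height. -/
lemma mem_sup_natEig (κ : Fin p ⊕ Fin q → ℂ) (v : LSpace κ) :
    v ∈ Submodule.span ℂ {hwVec κ} ⊔
      natEig (uAct (LSpace κ) (htMatrix p q)) ((∑ i, ht i * κ i) + 1) := by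
  obtain ⟨u, rfl⟩ := exists_smul_hwVec κ v
  refine smul_mem_sup_natEig _ _ (fun v hv => ?_) (fun i j hij v hv => ?_) u
    (Submodule.mem_span_singleton_self _)
  · obtain ⟨c, rfl⟩ := Submodule.mem_span_singleton.1 hv
    rw [map_smul, htMatrix_hwVec, smul_comm]
  · obtain ⟨c, rfl⟩ := Submodule.mem_span_singleton.1 hv
    rw [map_smul]
    refine Submodule.smul_mem _ _ ?_
    rcases hij.lt_or_eq with h | h
    · rw [raising_hwVec κ h]
      exact Submodule.zero_mem _
    · rw [ht_injective h, diag_hwVec]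
      exact Submodule.smul_mem _ _ (Submodule.mem_span_singleton_self _)

/-- Singular vectors of `L(κ)` have weight `κ`. -/
lemma singular_weight (κ : Fin p ⊕ Fin q → ℂ) {v : LSpace κ}
    (hv : ∀ i j : Fin p ⊕ Fin q, ht i < ht j → uAct (LSpace κ) (Matrix.single i j 1) v = 0)
    (i : Fin p ⊕ Fin q) : uAct (LSpace κ) (Matrix.single i i 1) v = κ i • v := by
  set H := uAct (LSpace κ) (htMatrix p q) with hH
  set y : ℂ := ∑ i, ht i * κ i with hy
  have hzero : ∀ w : LSpace κ, H w = y • w → w ∈ natEig H (y + 1) → w = 0 := by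
    intro w h1 h2
    by_contra h0
    obtain ⟨n, hn⟩ := exists_nat_of_mem_natEig h1 h2 h0
    have : ((n + 1 : ℕ) : ℂ) = 0 := by push_cast; linear_combination -hn
    exact absurd (Nat.cast_eq_zero.1 this) (Nat.succ_ne_zero n)
  have hle : ∀ w : LSpace κ, w ∈ natEig H y := by
    intro w
    refine (sup_le ?_ ?_ : Submodule.span ℂ {hwVec κ} ⊔ natEig H (y + 1) ≤ _) (mem_sup_natEig κ w)
    · rw [Submodule.span_singleton_le_iff_mem]
      exact mem_natEig_of_eq 0 (by rw [Nat.cast_zero, add_zero]) (htMatrix_hwVec κ)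
    · exact natEig_le fun n v hv => mem_natEig_of_eq (n + 1) (by push_cast; ring) hv
  obtain ⟨f, hf, hfv⟩ := exists_of_mem_natEig (hle v)
  -- A raising operator shifts all heights by the same amount, so the images of the components have
  -- distinct eigenvalues and vanish separately.
  have hsing : ∀ n, ∀ i j : Fin p ⊕ Fin q, ht i < ht j →
      uAct (LSpace κ) (Matrix.single i j 1) (f n) = 0 := by
    intro n i j hij
    by_cases hn : n ∈ f.support
    · refine eq_zero_of_sum_eigen_eq_zero (T := H) (y := y + (ht i - ht j))
        (g := fun n => uAct (LSpace κ) (Matrix.single i j 1) (f n)) (s := f.support)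
        (fun n => ?_) ?_ n hn
      · rw [hH, htMatrix_uAct_single i j (hf n)]
        congr 1
        ring
      · rw [← map_sum, hfv, hv i j hij]
    · rw [Finsupp.notMem_support_iff.1 hn, map_zero]
  -- A nonzero singular vector above the minimal height `y` would generate only heights at least `y
  -- + 1`, yet by irreducibility it generates the highest weight vector, of height `y`.
  have hpos : ∀ n, n ≠ 0 → f n = 0 := by
    intro n hn
    by_contra h0
    let K : Submodule ℂ (LSpace κ) :=
      { carrier := {w | H w = (y + n) • w ∧ ∀ i j : Fin p ⊕ Fin q, ht i < ht j →
          uAct (LSpace κ) (Matrix.single i j 1) w = 0}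
        zero_mem' := ⟨by simp, by simp⟩
        add_mem' := fun {s t} hs ht => ⟨by rw [map_add, hs.1, ht.1, smul_add],
          fun i j hij => by rw [map_add, hs.2 i j hij, ht.2 i j hij, add_zero]⟩
        smul_mem' := fun r t ht => ⟨by rw [map_smul, ht.1, smul_comm],
          fun i j hij => by rw [map_smul, ht.2 i j hij, smul_zero]⟩ }
    obtain ⟨u, hu⟩ := exists_smul_eq_of_ne_zero κ h0 (hwVec κ)
    have hmem := smul_mem_sup_natEig (p := p) (q := q) K (y + n) (fun v hv => hv.1)
      (fun i j hij w hw => ?_) u (show f n ∈ K from ⟨hf n, hsing n⟩)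
    · rw [hu] at hmem
      obtain ⟨m, rfl⟩ := Nat.exists_eq_succ_of_ne_zero hn
      have h1 : hwVec κ ∈ natEig H (y + 1) := by
        refine (sup_le ?_ ?_ : K ⊔ natEig H (y + (m.succ : ℕ) + 1) ≤ _) hmem
        · exact fun w hw => mem_natEig_of_eq m (by push_cast; ring) hw.1
        · exact natEig_le fun k v hv =>
            mem_natEig_of_eq (k + m.succ) (by push_cast; ring) hv
      -- Vanishing of the highest weight vector is contradictory here without knowing `L(κ) ≠ 0`: it
      -- would annihilate all of `L(κ)`, including `f m.succ`.
      have h2 := hzero _ (htMatrix_hwVec κ) h1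
      apply h0
      obtain ⟨u', hu'⟩ := exists_smul_hwVec κ (f m.succ)
      rw [hu', h2, smul_zero]
    · rcases hij.lt_or_eq with h | h
      · rw [hw.2 i j h]
        exact Submodule.zero_mem _
      · rw [ht_injective h]
        -- Diagonal units preserve height, and their bracket with `E_kl` is a multiple of `E_kl`, so
        -- they preserve singularity.
        refine ⟨?_, fun k l hkl => ?_⟩
        · have := htMatrix_uAct_single j j hw.1
          rwa [sub_self, add_zero] at this
        · rw [uAct_sbr (single_mem_homog k l) (single_mem_homog j j), hw.2 k l hkl, map_zero,
            smul_zero, add_zero, sbr]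
          simp only [map_sub, map_smul, LinearMap.sub_apply, LinearMap.smul_apply]
          by_cases h1 : l = j
          · subst h1
            by_cases h2 : l = k
            · subst h2; exact absurd hkl (lt_irrefl _)
            · rw [Matrix.single_mul_single_same, Matrix.single_mul_single_of_ne _ _ _ _ h2,
                one_mul, hw.2 k l hkl]
              simp
          · by_cases h2 : j = k
            · subst h2
              rw [Matrix.single_mul_single_same, Matrix.single_mul_single_of_ne _ _ _ _ h1,
                one_mul, hw.2 _ l hkl]
              simp
            · rw [Matrix.single_mul_single_of_ne _ _ _ _ h1,
                Matrix.single_mul_single_of_ne _ _ _ _ h2]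
              simp
  have hvH : H v = y • v := by
    rw [← hfv, map_sum, Finset.smul_sum]
    refine Finset.sum_congr rfl fun n _ => ?_
    by_cases hn : n = 0
    · rw [hn, hf 0]; simp
    · rw [hpos n hn]; simp
  obtain ⟨w, hw, l, hl, hwl⟩ := Submodule.mem_sup.1 (mem_sup_natEig κ v)
  obtain ⟨c, rfl⟩ := Submodule.mem_span_singleton.1 hw
  have hl0 : l = 0 := by
    refine hzero l ?_ hl
    rw [← sub_eq_of_eq_add' hwl.symm, map_sub, map_smul, hvH, smul_sub, hH, htMatrix_hwVec,
      smul_comm]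
  rw [← hwl, hl0, add_zero, map_smul, diag_hwVec, smul_comm]

end Singular

end SuperPair

namespace SuperPair

/-! ### Column degrees and lowest components in `S ⊗ V` -/

section Extraction

variable {p q : ℕ}

/-- The projection to the lower left block. -/
def lowerLeft (p q : ℕ) : G p q →ₗ[ℂ] G p q where
  toFun X := Matrix.fromBlocks 0 0 X.toBlocks₂₁ 0
  map_add' X Y := by
    rw [Matrix.fromBlocks_add]
    simp only [add_zero]
    rfl
  map_smul' c X := by
    rw [RingHom.id_apply, Matrix.fromBlocks_smul]
    simp only [smul_zero]
    rfl

lemma lowerLeft_apply (X : G p q) : lowerLeft p q X = Matrix.fromBlocks 0 0 X.toBlocks₂₁ 0 := rfl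

lemma isAbelianProjection_lowerLeft :
    IsAbelianProjection (parity₂ p q) (𝔮 p q) (lowerLeft p q) where
  sub_mem X i j := by simp [lowerLeft_apply, Matrix.toBlocks₂₁]
  eq_zero X hX := by
    ext i j
    rcases i with i | i <;> rcases j with j | j <;> simp [lowerLeft_apply, Matrix.toBlocks₂₁]
    exact hX i j
  isGraded := isGraded_𝔮 p q
  homog_mem a X hX := by
    rintro (i | i) (j | j) h
    · rfl
    · rfl
    · exact hX _ _ h
    · rfl
  mul_eq_zero X Y := by
    rw [lowerLeft_apply, lowerLeft_apply, Matrix.fromBlocks_multiply]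
    simp
  mul_mem X hX Y hY i j := by
    have h1 : ∀ i j, X (Sum.inr i) (Sum.inl j) = 0 := hX
    have h2 : ∀ i j, Y (Sum.inr i) (Sum.inl j) = 0 := hY
    simp [Matrix.mul_apply, h1, h2]

/-- The embedding of `gl(p|q)` as the upper left block. -/
def upperLeft : Matrix (Fin p ⊕ Fin q) (Fin p ⊕ Fin q) ℂ →ₗ[ℂ] 𝔨 p q where
  toFun X := ⟨Matrix.fromBlocks X 0 0 0, fun _ _ => ⟨rfl, rfl⟩⟩
  map_add' X Y := by
    apply Subtype.ext
    change _ = Matrix.fromBlocks _ _ _ _ + Matrix.fromBlocks _ _ _ _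
    rw [Matrix.fromBlocks_add]; simp
  map_smul' c X := by
    apply Subtype.ext
    change _ = c • Matrix.fromBlocks _ _ _ _
    rw [Matrix.fromBlocks_smul]; simp

lemma coe_upperLeft (X : Matrix (Fin p ⊕ Fin q) (Fin p ⊕ Fin q) ℂ) :
    (upperLeft X : G p q) = Matrix.fromBlocks X 0 0 0 := rfl

lemma upperLeft_mem {a : ZMod 2} {X : Matrix (Fin p ⊕ Fin q) (Fin p ⊕ Fin q) ℂ}
    (hX : X ∈ homog (parity p q) a) : (upperLeft X : G p q) ∈ homog (parity₂ p q) a := by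
  rintro (i | i) (j | j) h
  · exact hX _ _ h
  · rfl
  · rfl
  · rfl

/-- An upper left block times a lower left block is zero, so only right multiplication on `𝔭⁻`
remains. The resulting minus sign is why weights in `S` are nonpositive. -/
lemma sbr_upperLeft_lowerLeft (a b : ZMod 2) (X : Matrix (Fin p ⊕ Fin q) (Fin p ⊕ Fin q) ℂ)
    (Y : G p q) : sbr a b (upperLeft X : G p q) (lowerLeft p q Y) =
      -(sgn a b • lowerLeft p q (Y * upperLeft X)) := by
  have h : (Y * Matrix.fromBlocks X 0 0 0).toBlocks₂₁ = Y.toBlocks₂₁ * X := by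
    ext i j
    simp [Matrix.toBlocks₂₁, Matrix.mul_apply]
  rw [sbr, coe_upperLeft, lowerLeft_apply, lowerLeft_apply, h, Matrix.fromBlocks_multiply,
    Matrix.fromBlocks_multiply]
  simp

/-- Multiplication by a supersign as an automorphism of the supersymmetric algebra. -/
def symTwist (p q : ℕ) (a : ZMod 2) :
    SuperSym (parity₂ p q) (𝔮 p q) →ₐ[ℂ] SuperSym (parity₂ p q) (𝔮 p q) :=
  SuperSym.lift (SuperSym.gen (parity₂ p q) (𝔮 p q) ∘ₗ twist (parity₂ p q) a)
    (fun b c X hX Y hY => by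
      simp only [LinearMap.comp_apply, twist_of_mem hX, twist_of_mem hY, map_smul,
        smul_mul_assoc, mul_smul_comm, SuperSym.gen_mul_gen hX hY, smul_smul]
      congr 1
      ring)
    (fun X hX => by
      have hd := isGraded_𝔮 p q X hX
      rw [LinearMap.comp_apply]
      exact SuperSym.gen_eq_zero (Submodule.add_mem _ (hd 0) (Submodule.smul_mem _ _ (hd 1))))

lemma symTwist_gen (a : ZMod 2) {b : ZMod 2} {Y : G p q} (hY : Y ∈ homog (parity₂ p q) b) :
    symTwist p q a (SuperSym.gen (parity₂ p q) (𝔮 p q) Y) = sgn b a • SuperSym.gen (parity₂ p q) (𝔮 p q) Y := by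
  rw [symTwist, SuperSym.lift_gen, LinearMap.comp_apply, twist_of_mem hY, map_smul]

variable {V : Type} [AddCommGroup V] [Module ℂ V]

lemma map_symTwist_gen_smul (a : ZMod 2) (φ : Module.End ℂ V) {b : ZMod 2} {Y : G p q}
    (hY : Y ∈ homog (parity₂ p q) b) (t : SuperSym (parity₂ p q) (𝔮 p q) ⊗[ℂ] V) :
    TensorProduct.map (symTwist p q a).toLinearMap φ (SuperSym.gen (parity₂ p q) (𝔮 p q) Y • t) =
      sgn b a • SuperSym.gen (parity₂ p q) (𝔮 p q) Y • TensorProduct.map (symTwist p q a).toLinearMap φ t := by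
  induction t using TensorProduct.induction_on with
  | zero => simp
  | tmul x v =>
    rw [TensorProduct.smul_tmul', smul_eq_mul, TensorProduct.map_tmul, TensorProduct.map_tmul,
      AlgHom.toLinearMap_apply, AlgHom.toLinearMap_apply, map_mul, symTwist_gen a hY,
      TensorProduct.smul_tmul', smul_eq_mul, smul_mul_assoc, TensorProduct.smul_tmul']
  | add x y hx hy => rw [smul_add, map_add, hx, hy, map_add, smul_add, smul_add]

lemma lTensor_smul {A : Type*} [Ring A] [Algebra ℂ A] (φ : Module.End ℂ V) (x : A)
    (t : A ⊗[ℂ] V) : LinearMap.lTensor A φ (x • t) = x • LinearMap.lTensor A φ t := by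
  induction t using TensorProduct.induction_on with
  | zero => simp
  | tmul y v => rw [TensorProduct.smul_tmul', LinearMap.lTensor_tmul, LinearMap.lTensor_tmul,
      TensorProduct.smul_tmul']
  | add y z hy hz => rw [smul_add, map_add, hy, hz, map_add, smul_add]

lemma map_symTwist_symTwist (a : ZMod 2) (φ : Module.End ℂ V)
    (t : SuperSym (parity₂ p q) (𝔮 p q) ⊗[ℂ] V) :
    TensorProduct.map (symTwist p q a).toLinearMap LinearMap.id
      (TensorProduct.map (symTwist p q a).toLinearMap φ t) = LinearMap.lTensor _ φ t := by
  suffices h : TensorProduct.map (symTwist p q a).toLinearMap LinearMap.id ∘ₗ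
      TensorProduct.map (symTwist p q a).toLinearMap φ = LinearMap.lTensor _ φ from
    LinearMap.congr_fun h t
  refine SuperSym.tensor_linearMap_eq (fun v => ?_) fun b Y hY t ht => ?_
  · simp
  · rw [LinearMap.comp_apply] at ht ⊢
    rw [map_symTwist_gen_smul a φ hY, map_smul, map_symTwist_gen_smul a _ hY, ht, smul_smul,
      sgn_mul_self, one_smul, lTensor_smul]

/-- The action of the upper left `gl(p|q)` on `S ⊗ V`. -/
abbrev rhoUL (M : SuperModule (parity₂ p q) (𝔨 p q) V)
    (X : Matrix (Fin p ⊕ Fin q) (Fin p ⊕ Fin q) ℂ) :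
    Module.End ℂ (SuperSym (parity₂ p q) (𝔮 p q) ⊗[ℂ] V) :=
  isAbelianProjection_lowerLeft.rho (inflate M) (upperLeft X)

lemma rhoUL_one_tmul (M : SuperModule (parity₂ p q) (𝔨 p q) V)
    (X : Matrix (Fin p ⊕ Fin q) (Fin p ⊕ Fin q) ℂ) (v : V) :
    rhoUL M X (1 ⊗ₜ v) = 1 ⊗ₜ M.act (upperLeft X) v := by
  have h : (upperLeft X : G p q) ∈ 𝔮 p q := 𝔨_le_𝔮 (upperLeft X).2
  rw [rhoUL, IsAbelianProjection.rho_one_tmul, SuperSym.gen_eq_zero h, TensorProduct.zero_tmul,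
    zero_add, IsAbelianProjection.toSub_of_mem _ h]
  rfl

lemma rhoUL_gen_smul (M : SuperModule (parity₂ p q) (𝔨 p q) V) {a b : ZMod 2}
    {X : Matrix (Fin p ⊕ Fin q) (Fin p ⊕ Fin q) ℂ} (hX : X ∈ homog (parity p q) a)
    {Y : G p q} (hY : Y ∈ homog (parity₂ p q) b)
    (t : SuperSym (parity₂ p q) (𝔮 p q) ⊗[ℂ] V) :
    rhoUL M X (SuperSym.gen (parity₂ p q) (𝔮 p q) Y • t) =
      sgn a b • (SuperSym.gen (parity₂ p q) (𝔮 p q) Y • rhoUL M X t -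
        SuperSym.gen (parity₂ p q) (𝔮 p q) (Y * upperLeft X) • t) := by
  rw [rhoUL, IsAbelianProjection.rho_gen_smul _ _ (upperLeft_mem hX) hY,
    sbr_upperLeft_lowerLeft, map_neg, map_smul, LinearMap.neg_apply, LinearMap.smul_apply,
    IsAbelianProjection.rho_map _ _ (homog_mul hY (upperLeft_mem hX)), smul_sub]
  abel

/-- The operator multiplying a product of generators in columns `b₁, …, b_k` by
`c b₁ + ⋯ + c b_k`. -/
def colDegree (M : SuperModule (parity₂ p q) (𝔨 p q) V) (c : Fin p ⊕ Fin q → ℕ) :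
    Module.End ℂ (SuperSym (parity₂ p q) (𝔮 p q) ⊗[ℂ] V) :=
  LinearMap.lTensor _ (M.act (upperLeft (Matrix.diagonal fun i => (c i : ℂ)))) -
    rhoUL M (Matrix.diagonal fun i => (c i : ℂ))

lemma colDegree_one_tmul (M : SuperModule (parity₂ p q) (𝔨 p q) V) (c : Fin p ⊕ Fin q → ℕ)
    (v : V) : colDegree M c (1 ⊗ₜ v) = 0 := by
  rw [colDegree, LinearMap.sub_apply, rhoUL_one_tmul, LinearMap.lTensor_tmul, sub_self]

lemma colDegree_gen_smul (M : SuperModule (parity₂ p q) (𝔨 p q) V) (c : Fin p ⊕ Fin q → ℕ)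
    {b : ZMod 2} {Y : G p q} (hY : Y ∈ homog (parity₂ p q) b)
    (t : SuperSym (parity₂ p q) (𝔮 p q) ⊗[ℂ] V) :
    colDegree M c (SuperSym.gen (parity₂ p q) (𝔮 p q) Y • t) =
      SuperSym.gen (parity₂ p q) (𝔮 p q) Y • colDegree M c t +
        SuperSym.gen (parity₂ p q) (𝔮 p q)
          (Y * upperLeft (Matrix.diagonal fun i => (c i : ℂ))) • t := by
  rw [colDegree, LinearMap.sub_apply, LinearMap.sub_apply, lTensor_smul,
    rhoUL_gen_smul M (diagonal_mem_homog _ _) hY, sgn_zero_left, one_smul, smul_sub]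
  abel

/-- Multiplying by a matrix unit of the lower left block in column `j` raises the eigenvalue by the
natural number `c j`; the other matrix units vanish in `S`. Hence `S ⊗ V` is spanned by eigenvectors
with eigenvalues in `ℕ`. -/
lemma natEig_colDegree (M : SuperModule (parity₂ p q) (𝔨 p q) V) (c : Fin p ⊕ Fin q → ℕ)
    (t : SuperSym (parity₂ p q) (𝔮 p q) ⊗[ℂ] V) : t ∈ natEig (colDegree M c) 0 := by
  have key : ∀ i j (t), t ∈ natEig (colDegree M c) 0 →
      SuperSym.gen (parity₂ p q) (𝔮 p q) (Matrix.single i j 1) • t ∈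
        natEig (colDegree M c) 0 := by
    intro i j t ht
    let P : Submodule ℂ (SuperSym (parity₂ p q) (𝔮 p q) ⊗[ℂ] V) :=
      (natEig (colDegree M c) 0).comap
        (IsAbelianProjection.genAct (parity₂ p q) (𝔮 p q) V (Matrix.single i j 1))
    suffices h : natEig (colDegree M c) 0 ≤ P from h ht
    refine natEig_le fun n t ht => ?_
    change SuperSym.gen (parity₂ p q) (𝔮 p q) (Matrix.single i j 1) • t ∈
      natEig (colDegree M c) 0
    have hq : ∀ k l, (k, l) ≠ (i, j) → (Matrix.single i j (1 : ℂ)) k l = 0 := by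
      rintro k l h
      refine Matrix.single_apply_of_ne _ _ _ _ _ ?_
      rintro ⟨rfl, rfl⟩
      exact h rfl
    have hhom : Matrix.single i j (1 : ℂ) ∈
        homog (parity₂ p q) (parity₂ p q i + parity₂ p q j) := by
      intro k l h
      refine hq k l fun e => ?_
      rw [Prod.mk.injEq] at e
      exact h (e.1 ▸ e.2 ▸ rfl)
    have hzero : Matrix.single i j (1 : ℂ) ∈ 𝔮 p q →
        SuperSym.gen (parity₂ p q) (𝔮 p q) (Matrix.single i j 1) • t ∈
          natEig (colDegree M c) 0 := by
      intro h
      rw [SuperSym.gen_eq_zero h, zero_smul]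
      exact Submodule.zero_mem _
    rcases i with i | i
    · exact hzero fun k l => hq _ _ (by simp)
    rcases j with j | j
    swap
    · exact hzero fun k l => hq _ _ (by simp)
    refine mem_natEig_of_eq (n + c j) rfl ?_
    have e : Matrix.single (Sum.inr i) (Sum.inl j) (1 : ℂ) *
        (upperLeft (Matrix.diagonal fun i => (c i : ℂ)) : G p q) =
        (c j : ℂ) • Matrix.single (Sum.inr i) (Sum.inl j) (1 : ℂ) := by
      have e' : (upperLeft (Matrix.diagonal fun i => (c i : ℂ)) : G p q) =
          Matrix.diagonal (Sum.elim (fun i => (c i : ℂ)) fun _ => 0) := by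
        rw [coe_upperLeft]
        exact (congrArg (Matrix.fromBlocks _ 0 0) Matrix.diagonal_zero.symm).trans
          (Matrix.fromBlocks_diagonal _ _)
      rw [e']
      ext k l
      rw [Matrix.mul_diagonal, Matrix.smul_apply, Matrix.single_apply, smul_eq_mul]
      split_ifs with h
      · rw [← h.2]; simp
      · simp
    rw [colDegree_gen_smul M c hhom, ht, e, map_smul, smul_assoc, smul_comm, ← add_smul]
    congr 1
    push_cast
    ring
  have htop : natEig (colDegree M c) 0 = ⊤ := by
    refine SuperSym.tensor_eq_top _ (fun v => ?_) fun b Y hY t ht => ?_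
    · exact mem_natEig_of_eq 0 (x := 0) (by simp) (by rw [colDegree_one_tmul, zero_smul])
    · rw [Matrix.matrix_eq_sum_single Y, map_sum, Finset.sum_smul]
      refine Submodule.sum_mem _ fun i _ => ?_
      rw [map_sum, Finset.sum_smul]
      refine Submodule.sum_mem _ fun j _ => ?_
      rw [show Matrix.single i j (Y i j) = Y i j • Matrix.single i j (1 : ℂ) by
        rw [Matrix.smul_single, smul_eq_mul, mul_one], map_smul, smul_assoc]
      exact Submodule.smul_mem _ _ (key i j t ht)
  exact htop ▸ Submodule.mem_top

lemma colDegree_map_symTwist (M : SuperModule (parity₂ p q) (𝔨 p q) V)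
    (c : Fin p ⊕ Fin q → ℕ) (a : ZMod 2) (φ : Module.End ℂ V)
    (t : SuperSym (parity₂ p q) (𝔮 p q) ⊗[ℂ] V) :
    colDegree M c (TensorProduct.map (symTwist p q a).toLinearMap φ t) =
      TensorProduct.map (symTwist p q a).toLinearMap φ (colDegree M c t) := by
  suffices h : colDegree M c ∘ₗ TensorProduct.map (symTwist p q a).toLinearMap φ =
      TensorProduct.map (symTwist p q a).toLinearMap φ ∘ₗ colDegree M c from
    LinearMap.congr_fun h t
  refine SuperSym.tensor_linearMap_eq (fun v => ?_) fun b Y hY t ht => ?_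
  · simp [colDegree_one_tmul]
  · rw [LinearMap.comp_apply, LinearMap.comp_apply] at ht ⊢
    have hYH := homog_mul hY (upperLeft_mem
      (diagonal_mem_homog (parity p q) fun i => (c i : ℂ)))
    rw [add_zero] at hYH
    rw [map_symTwist_gen_smul a φ hY, map_smul, colDegree_gen_smul M c hY, ht,
      colDegree_gen_smul M c hY, map_add, map_symTwist_gen_smul a φ hY,
      map_symTwist_gen_smul a φ hYH, smul_add]

/-- The part of the action of the upper left `gl(p|q)` coming from the supersymmetric algebra. -/
def symAct (M : SuperModule (parity₂ p q) (𝔨 p q) V) (a : ZMod 2)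
    (X : Matrix (Fin p ⊕ Fin q) (Fin p ⊕ Fin q) ℂ) :
    Module.End ℂ (SuperSym (parity₂ p q) (𝔮 p q) ⊗[ℂ] V) :=
  rhoUL M X - TensorProduct.map (symTwist p q a).toLinearMap (M.act (upperLeft X))

lemma symAct_one_tmul (M : SuperModule (parity₂ p q) (𝔨 p q) V) (a : ZMod 2)
    (X : Matrix (Fin p ⊕ Fin q) (Fin p ⊕ Fin q) ℂ) (v : V) : symAct M a X (1 ⊗ₜ v) = 0 := by
  rw [symAct, LinearMap.sub_apply, rhoUL_one_tmul, TensorProduct.map_tmul,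
    AlgHom.toLinearMap_apply, map_one, sub_self]

/-- A superderivation rule: each generator `Y` is replaced in turn by `-Y X`, up to the supersign.
For `X = E_ij` this moves a generator from column `i` to column `j`. -/
lemma symAct_gen_smul (M : SuperModule (parity₂ p q) (𝔨 p q) V) {a b : ZMod 2}
    {X : Matrix (Fin p ⊕ Fin q) (Fin p ⊕ Fin q) ℂ} (hX : X ∈ homog (parity p q) a)
    {Y : G p q} (hY : Y ∈ homog (parity₂ p q) b)
    (t : SuperSym (parity₂ p q) (𝔮 p q) ⊗[ℂ] V) :
    symAct M a X (SuperSym.gen (parity₂ p q) (𝔮 p q) Y • t) =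
      sgn a b • (SuperSym.gen (parity₂ p q) (𝔮 p q) Y • symAct M a X t -
        SuperSym.gen (parity₂ p q) (𝔮 p q) (Y * upperLeft X) • t) := by
  rw [symAct, LinearMap.sub_apply, LinearMap.sub_apply, rhoUL_gen_smul M hX hY,
    map_symTwist_gen_smul a _ hY, sgn_comm b a, smul_sub, smul_sub, smul_sub, smul_sub]
  abel

/-- Both operators come from right multiplication on generators, so their commutator reflects the
one of `X` with the diagonal matrix. For `X = E_ij` the shift is `k = c j - c i`. -/
lemma colDegree_symAct (M : SuperModule (parity₂ p q) (𝔨 p q) V) (c : Fin p ⊕ Fin q → ℕ)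
    {a : ZMod 2} {X : Matrix (Fin p ⊕ Fin q) (Fin p ⊕ Fin q) ℂ} (hX : X ∈ homog (parity p q) a)
    {k : ℂ} (hk : X * Matrix.diagonal (fun i => (c i : ℂ)) -
      Matrix.diagonal (fun i => (c i : ℂ)) * X = k • X)
    (t : SuperSym (parity₂ p q) (𝔮 p q) ⊗[ℂ] V) :
    colDegree M c (symAct M a X t) = symAct M a X (colDegree M c t) + k • symAct M a X t := by
  suffices h : colDegree M c ∘ₗ symAct M a X =
      symAct M a X ∘ₗ colDegree M c + k • symAct M a X from LinearMap.congr_fun h t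
  have hk' : ∀ Y : G p q, Y * upperLeft X * upperLeft (Matrix.diagonal fun i => (c i : ℂ)) =
      Y * upperLeft (Matrix.diagonal fun i => (c i : ℂ)) * upperLeft X +
        k • (Y * upperLeft X) := by
    intro Y
    have e : (upperLeft X : G p q) * upperLeft (Matrix.diagonal fun i => (c i : ℂ)) =
        upperLeft (Matrix.diagonal fun i => (c i : ℂ)) * upperLeft X + k • upperLeft X := by
      rw [← Submodule.coe_smul, ← map_smul, ← hk]
      simp only [coe_upperLeft, Matrix.fromBlocks_multiply, Matrix.fromBlocks_add]
      simp
    rw [mul_assoc, e, mul_add, mul_assoc, mul_smul_comm]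
  refine SuperSym.tensor_linearMap_eq (fun v => ?_) fun b Y hY t ht => ?_
  · simp [colDegree_one_tmul, symAct_one_tmul]
  · rw [LinearMap.comp_apply, LinearMap.add_apply, LinearMap.comp_apply,
      LinearMap.smul_apply] at ht ⊢
    have hYH := homog_mul hY (upperLeft_mem
      (diagonal_mem_homog (parity p q) fun i => (c i : ℂ)))
    rw [add_zero] at hYH
    rw [symAct_gen_smul M hX hY, map_smul, map_sub, colDegree_gen_smul M c hY,
      colDegree_gen_smul M c (homog_mul hY (upperLeft_mem hX)), ht, colDegree_gen_smul M c hY,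
      map_add, symAct_gen_smul M hX hY, symAct_gen_smul M hX hYH, hk', map_add, map_smul,
      smul_comm k, ← smul_add, ← smul_add]
    congr 1
    simp only [smul_add, add_smul, smul_sub, smul_assoc,
      smul_comm (SuperSym.gen (parity₂ p q) (𝔮 p q) Y) k]
    abel

lemma rhoUL_eq (M : SuperModule (parity₂ p q) (𝔨 p q) V) (a : ZMod 2)
    (X : Matrix (Fin p ⊕ Fin q) (Fin p ⊕ Fin q) ℂ)
    (t : SuperSym (parity₂ p q) (𝔮 p q) ⊗[ℂ] V) :
    rhoUL M X t = symAct M a X t +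
      TensorProduct.map (symTwist p q a).toLinearMap (M.act (upperLeft X)) t := by
  rw [symAct, LinearMap.sub_apply, sub_add_cancel]

/-- From a singular vector in `S ⊗ V` of weight `η` one obtains a vector of weight `η` which
is annihilated by the raising operators acting on the second factor. -/
lemma exists_lTensor_singular (M : SuperModule (parity₂ p q) (𝔨 p q) V)
    (η : Fin p ⊕ Fin q → ℂ) {w : SuperSym (parity₂ p q) (𝔮 p q) ⊗[ℂ] V} (hw : w ≠ 0)
    (hup : ∀ i j : Fin p ⊕ Fin q, ht i < ht j → rhoUL M (Matrix.single i j 1) w = 0)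
    (hdiag : ∀ i : Fin p ⊕ Fin q, rhoUL M (Matrix.single i i 1) w = η i • w) :
    ∃ w' ≠ 0, (∀ i j : Fin p ⊕ Fin q, ht i < ht j →
      LinearMap.lTensor (SuperSym (parity₂ p q) (𝔮 p q))
        (M.act (upperLeft (Matrix.single i j 1))) w' = 0) ∧
      ∀ i : Fin p ⊕ Fin q, rhoUL M (Matrix.single i i 1) w' = η i • w' := by
  have hk : ∀ i j : Fin p ⊕ Fin q, Matrix.single i j (1 : ℂ) *
      Matrix.diagonal (fun i => (ht i : ℂ)) - Matrix.diagonal (fun i => (ht i : ℂ)) *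
        Matrix.single i j (1 : ℂ) = ((ht j : ℂ) - ht i) • Matrix.single i j (1 : ℂ) := by
    intro i j
    rw [← neg_sub, diagonal_bracket_single, ← neg_smul, neg_sub]
  obtain ⟨f, hf, hfw⟩ := exists_of_mem_natEig (natEig_colDegree M ht w)
  have hne : f.support.Nonempty := by
    rw [Finset.nonempty_iff_ne_empty]
    intro h
    rw [h, Finset.sum_empty] at hfw
    exact hw hfw.symm
  have hmin := Finset.min'_mem f.support hne
  -- The component of least degree is the required vector.
  set m := f.support.min' hne with hm
  refine ⟨f m, Finsupp.mem_support_iff.1 hmin, fun i j hij => ?_, fun i => ?_⟩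
  · set a := parity p q i + parity p q j with ha
    have hX : Matrix.single i j (1 : ℂ) ∈ homog (parity p q) a := single_mem_homog i j
    set τ := TensorProduct.map (symTwist p q a).toLinearMap
      (M.act (upperLeft (Matrix.single i j 1))) with hτ
    have hQ : ∀ n, colDegree M ht (symAct M a (Matrix.single i j 1) (f n)) =
        (0 + (n : ℂ) + (ht j - ht i)) • symAct M a (Matrix.single i j 1) (f n) := by
      intro n
      rw [colDegree_symAct M ht hX (hk i j), hf, map_smul, ← add_smul]
    have hT : ∀ n, colDegree M ht (τ (f n)) = (0 + (n : ℂ)) • τ (f n) := by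
      intro n
      rw [hτ, colDegree_map_symTwist, hf, map_smul]
    obtain ⟨d, hd⟩ := Nat.exists_eq_add_of_lt hij
    -- In the equation `E_ij w = 0`, the term `τ (f m)` has degree `m`, while every other term has
    -- degree at least `m + 1`: `τ` preserves the degree and `symAct` raises it by `ht j - ht i`.
    have hsum : τ (f m) = -(∑ n ∈ f.support.erase m, τ (f n) +
        ∑ n ∈ f.support, symAct M a (Matrix.single i j 1) (f n)) := by
      have h := hup i j hij
      rw [rhoUL_eq M a, ← hfw, map_sum, map_sum, ← Finset.add_sum_erase _ _ hmin] at h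
      rw [eq_neg_iff_add_eq_zero, ← add_assoc, hτ, ← h]
      rw [← Finset.add_sum_erase _ _ hmin, ← Finset.add_sum_erase f.support _ hmin]
      abel
    have hmem : τ (f m) ∈ natEig (colDegree M ht) ((m : ℂ) + 1) := by
      rw [hsum]
      refine Submodule.neg_mem _ (Submodule.add_mem _ (Submodule.sum_mem _ fun n hn => ?_)
        (Submodule.sum_mem _ fun n hn => ?_))
      · have hlt : m < n := lt_of_le_of_ne (Finset.min'_le _ _ (Finset.mem_of_mem_erase hn))
          (Finset.ne_of_mem_erase hn).symm
        obtain ⟨e, he⟩ := Nat.exists_eq_add_of_lt hlt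
        refine mem_natEig_of_eq e ?_ (hT n)
        rw [he]
        push_cast
        ring
      · obtain ⟨e, he⟩ := Nat.exists_eq_add_of_le (Finset.min'_le _ _ hn)
        refine mem_natEig_of_eq (e + d) ?_ (hQ n)
        rw [he, hd]
        push_cast
        ring
    have h0 : τ (f m) = 0 := by
      by_contra h0
      obtain ⟨n, hn⟩ := exists_nat_of_mem_natEig (hT m) hmem h0
      have : ((n + 1 : ℕ) : ℂ) = 0 := by push_cast; linear_combination -hn
      exact absurd (Nat.cast_eq_zero.1 this) (Nat.succ_ne_zero n)
    -- Applying the sign twist of `S` once more cancels the supersign in `τ`, leaving the plain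
    -- operator on the second factor.
    rw [← map_symTwist_symTwist a, ← hτ, h0, map_zero]
  · have h2 : ∀ x : ZMod 2, x + x = 0 := by decide
    have hX : Matrix.single i i (1 : ℂ) ∈ homog (parity p q) 0 := by
      have := single_mem_homog i i
      rwa [h2] at this
    rw [← sub_eq_zero]
    -- Diagonal units preserve the column degree, so the weight equation for `w` splits into its
    -- homogeneous components.
    refine eq_zero_of_sum_eigen_eq_zero (T := colDegree M ht) (y := 0) (s := f.support)
      (g := fun n => rhoUL M (Matrix.single i i 1) (f n) - η i • f n) (fun n => ?_) ?_ m hmin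
    · rw [map_sub, map_smul, rhoUL_eq M 0, map_add, colDegree_symAct M ht hX (hk i i),
        colDegree_map_symTwist, hf, sub_self, zero_smul, add_zero, map_smul, map_smul, ← smul_add,
        smul_sub, smul_comm (η i)]
    · rw [Finset.sum_sub_distrib, ← map_sum, ← Finset.smul_sum, hfw, hdiag, sub_self]

end Extraction

end SuperPair

namespace SuperPair

/-! ### Common kernels and tensor products -/

section Separation

variable {V A : Type*} [AddCommGroup V] [Module ℂ V] [AddCommGroup A] [Module ℂ A]

/-- An endomorphism vanishing on the common kernel of a family of endomorphisms keeps this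
property after tensoring on the left. -/
lemma lTensor_apply_eq_zero {I : Type*} {φ : I → Module.End ℂ V} {θ : Module.End ℂ V}
    (h : ∀ v, (∀ i, φ i v = 0) → θ v = 0) {w : A ⊗[ℂ] V}
    (hw : ∀ i, LinearMap.lTensor A (φ i) w = 0) : LinearMap.lTensor A θ w = 0 := by
  classical
  -- Expanding along a basis of `A`, the operators act coordinatewise, so the hypothesis applies to
  -- each coordinate of `w`.
  let b := Module.Basis.ofVectorSpace ℂ A
  have key : ∀ (ψ : Module.End ℂ V) (k) (w : A ⊗[ℂ] V), TensorProduct.equivFinsuppOfBasisLeft b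
      (LinearMap.lTensor A ψ w) k = ψ (TensorProduct.equivFinsuppOfBasisLeft b w k) := by
    intro ψ k w
    induction w using TensorProduct.induction_on with
    | zero => simp
    | tmul x v => simp
    | add x y hx hy => simp only [map_add, Finsupp.add_apply, hx, hy]
  apply (TensorProduct.equivFinsuppOfBasisLeft (N := V) b).injective
  ext k
  rw [key, map_zero, Finsupp.coe_zero, Pi.zero_apply]
  refine h _ fun i => ?_
  rw [← key, hw, map_zero, Finsupp.coe_zero, Pi.zero_apply]

/-- An endomorphism vanishing on the common kernel of a family of endomorphisms keeps this
property after tensoring on the right. -/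
lemma rTensor_apply_eq_zero {I : Type*} {φ : I → Module.End ℂ V} {θ : Module.End ℂ V}
    (h : ∀ v, (∀ i, φ i v = 0) → θ v = 0) {w : V ⊗[ℂ] A}
    (hw : ∀ i, LinearMap.rTensor A (φ i) w = 0) : LinearMap.rTensor A θ w = 0 := by
  have key : ∀ (ψ : Module.End ℂ V) (w : V ⊗[ℂ] A), TensorProduct.comm ℂ V A
      (LinearMap.rTensor A ψ w) = LinearMap.lTensor A ψ (TensorProduct.comm ℂ V A w) := by
    intro ψ w
    induction w using TensorProduct.induction_on with
    | zero => simp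
    | tmul x v => simp
    | add x y hx hy => simp only [map_add, hx, hy]
  apply (TensorProduct.comm ℂ V A).injective
  rw [key, map_zero]
  refine lTensor_apply_eq_zero h fun i => ?_
  rw [← key, hw, map_zero]

end Separation

/-! ### From homomorphisms to weights and partitions -/

section Main

variable {p q : ℕ}

lemma SuperModule.exists_mem_homOfParity {ι : Type} [Fintype ι] {π : ι → ZMod 2}
    {𝔰 : Submodule ℂ (Matrix ι ι ℂ)} {V₁ V₂ : Type} [AddCommGroup V₁] [Module ℂ V₁]
    [AddCommGroup V₂] [Module ℂ V₂] {M : SuperModule π 𝔰 V₁} {N : SuperModule π 𝔰 V₂}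
    (h : M.Hom N ≠ ⊥) : ∃ c, ∃ f ∈ M.homOfParity N c, f ≠ 0 := by
  by_contra! h'
  have hbot : ∀ c, M.homOfParity N c = ⊥ := fun c => (Submodule.eq_bot_iff _).2 (h' c)
  exact h (by rw [SuperModule.Hom, hbot, hbot, sup_bot_eq])

lemma outer_act_upperLeft {V₁ V₂ : Type} [AddCommGroup V₁] [Module ℂ V₁] [AddCommGroup V₂]
    [Module ℂ V₂] (M : SuperModule (parity p q) ⊤ V₁) (N : SuperModule (parity p q) ⊤ V₂)
    (X : Matrix (Fin p ⊕ Fin q) (Fin p ⊕ Fin q) ℂ) :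
    (outer M N).act (upperLeft X) = LinearMap.rTensor _ (M.act (full X)) := by
  have h1 : blk₁ (upperLeft X : G p q) = X := rfl
  have h2 : blk₂ (upperLeft X : G p q) = 0 := rfl
  have h3 : full (0 : Matrix (Fin p ⊕ Fin q) (Fin p ⊕ Fin q) ℂ) = 0 := rfl
  change outerAct _ _ (upperLeft X) = _
  simp only [outerAct, LinearMap.coe_mk, AddHom.coe_mk, h1, h2, map_zero, h3,
    TensorProduct.map_zero_right, add_zero]
  rfl

lemma hom_outer_upperLeft {V₁ V₂ V₃ : Type} [AddCommGroup V₁] [Module ℂ V₁] [AddCommGroup V₂]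
    [Module ℂ V₂] [AddCommGroup V₃] [Module ℂ V₃] {M : SuperModule (parity p q) ⊤ V₁}
    {N : SuperModule (parity p q) ⊤ V₂} {T : SuperModule (parity₂ p q) (𝔨 p q) V₃} {c : ZMod 2}
    {f : V₁ ⊗[ℂ] V₂ →ₗ[ℂ] V₃} (hf : f ∈ (outer M N).homOfParity T c) {a : ZMod 2}
    {X : Matrix (Fin p ⊕ Fin q) (Fin p ⊕ Fin q) ℂ} (hX : X ∈ homog (parity p q) a)
    (x : V₁) (y : V₂) :
    f (M.act (full X) x ⊗ₜ y) = sgn a c • T.act (upperLeft X) (f (x ⊗ₜ y)) := by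
  have := hf.2 a (upperLeft X) (upperLeft_mem hX) (x ⊗ₜ y)
  rwa [outer_act_upperLeft, LinearMap.rTensor_tmul] at this

lemma L_act_full (κ : Fin p ⊕ Fin q → ℂ) (X : Matrix (Fin p ⊕ Fin q) (Fin p ⊕ Fin q) ℂ) :
    (L κ).act (full X) = uAct (LSpace κ) X := rfl

lemma W_act_upperLeft (lam : YoungDiagram) (X : Matrix (Fin p ⊕ Fin q) (Fin p ⊕ Fin q) ℂ) :
    (W p q lam).act (upperLeft X) = LinearMap.rTensor _ (uAct (LSpace (natWeight lam)) X) := by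
  rw [W, outer_act_upperLeft, L_act_full]

/-- A nonzero homomorphism from `L(κ) ⊗ V₂` does not vanish on the product of the highest weight
vector and some vector. -/
lemma exists_hwVec_tmul_ne_zero {κ : Fin p ⊕ Fin q → ℂ} {V₂ V₃ : Type} [AddCommGroup V₂]
    [Module ℂ V₂] [AddCommGroup V₃] [Module ℂ V₃] {N : SuperModule (parity p q) ⊤ V₂}
    {T : SuperModule (parity₂ p q) (𝔨 p q) V₃} {c : ZMod 2}
    {f : LSpace κ ⊗[ℂ] V₂ →ₗ[ℂ] V₃} (hf : f ∈ (outer (L κ) N).homOfParity T c)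
    (h0 : f ≠ 0) : ∃ y, f (hwVec κ ⊗ₜ y) ≠ 0 := by
  by_contra! h
  -- The vectors `x` with `f (x ⊗ y) = 0` for all `y` form a submodule, since the upper left block
  -- moves only the first factor; containing the generator `hwVec κ`, it would be everything.
  let P : Submodule ℂ (LSpace κ) := LinearMap.ker (TensorProduct.curry f)
  have hP : ∀ x, x ∈ P ↔ ∀ y, f (x ⊗ₜ y) = 0 := fun x =>
    LinearMap.mem_ker.trans LinearMap.ext_iff
  have hstab : ∀ a, ∀ X ∈ homog (parity p q) a, ∀ x ∈ P, U.of (parity p q) X • x ∈ P := by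
    intro a X hX x hx
    rw [hP] at hx ⊢
    intro y
    have := hom_outer_upperLeft hf hX x y
    rwa [hx, map_zero, smul_zero] at this
  apply h0
  refine TensorProduct.ext' fun x y => ?_
  obtain ⟨u, rfl⟩ := exists_smul_hwVec _ x
  exact (hP _).1 (U.smul_mem_of_forall P hstab u _ ((hP _).2 h)) y

lemma diagonal_indicator {ι : Type*} [DecidableEq ι] (i : ι) :
    (Matrix.diagonal fun k => (((if k = i then 1 else 0 : ℕ)) : ℂ)) = Matrix.single i i 1 := by
  ext k l
  rw [Matrix.diagonal_apply, Matrix.single_apply]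
  by_cases h1 : k = l <;> by_cases h2 : k = i <;> by_cases h3 : l = i <;> simp_all [eq_comm]

/-- A nonzero homomorphism from `L(η) ⊗ V₂` to an induced module yields a vector of weight `η` in
`S ⊗ V` annihilated by the raising operators acting on the second factor. -/
lemma exists_lTensor_singular_of_hom {η : Fin p ⊕ Fin q → ℂ} {V₂ V : Type} [AddCommGroup V₂]
    [Module ℂ V₂] [AddCommGroup V] [Module ℂ V] {N : SuperModule (parity p q) ⊤ V₂}
    {M : SuperModule (parity₂ p q) (𝔨 p q) V} {c : ZMod 2}
    {f : LSpace η ⊗[ℂ] V₂ →ₗ[ℂ] (inflate M).IndSpace}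
    (hf : f ∈ (outer (L η) N).homOfParity
      (((inflate M).Ind (isGraded_𝔮 p q)).restrict (𝔰 := 𝔨 p q) le_top) c) (hf0 : f ≠ 0) :
    ∃ w ≠ 0, (∀ i j : Fin p ⊕ Fin q, ht i < ht j →
      LinearMap.lTensor (SuperSym (parity₂ p q) (𝔮 p q))
        (M.act (upperLeft (Matrix.single i j 1))) w = 0) ∧
      ∀ i : Fin p ⊕ Fin q, rhoUL M (Matrix.single i i 1) w = η i • w := by
  obtain ⟨y, hy⟩ := exists_hwVec_tmul_ne_zero hf hf0
  set z := f (hwVec η ⊗ₜ y) with hz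
  have hd := isAbelianProjection_lowerLeft (p := p) (q := q)
  have hw : hd.toTensor (inflate M) z ≠ 0 := fun e =>
    hy (hd.toTensor_injective _ (e.trans (map_zero _).symm))
  have hact : ∀ i j : Fin p ⊕ Fin q,
      f (uAct (LSpace η) (Matrix.single i j 1) (hwVec η) ⊗ₜ y) =
      sgn (parity p q i + parity p q j) c • (U.of (parity₂ p q)
        (upperLeft (Matrix.single i j 1) : G p q) • z) := fun i j =>
    hom_outer_upperLeft hf (single_mem_homog i j) (hwVec η) y
  refine exists_lTensor_singular M η hw (fun i j hij => ?_) fun i => ?_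
  · have := hact i j
    rw [raising_hwVec _ hij, TensorProduct.zero_tmul, map_zero, eq_comm, smul_eq_zero_iff_right
      (sgn_ne_zero _ _)] at this
    rw [rhoUL, ← hd.toTensor_of_smul, this, map_zero]
  · have h2 : ∀ x : ZMod 2, x + x = 0 := by decide
    have := hact i i
    rw [diag_hwVec, ← TensorProduct.smul_tmul', map_smul, ← hz, h2, sgn_zero_left,
      one_smul] at this
    rw [rhoUL, ← hd.toTensor_of_smul, ← this, map_smul]

/-- If `W_μ` maps nontrivially to `I_λ`, then `λ^♮ - μ^♮` has entries in `ℕ`. -/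
lemma natWeight_sub_eq_natCast {lam mu : YoungDiagram}
    (h : (W p q mu).Hom ((I p q lam).restrict (𝔰 := 𝔨 p q) le_top) ≠ ⊥)
    (i : Fin p ⊕ Fin q) : ∃ n : ℕ, natWeight lam i = natWeight mu i + n := by
  obtain ⟨c, f, hf, hf0⟩ := SuperModule.exists_mem_homOfParity h
  obtain ⟨w, hw0, hup, hdiag⟩ := exists_lTensor_singular_of_hom (η := natWeight mu)
    (N := (L (natWeight mu)).contragredient) (M := W p q lam) (c := c) (f := f) hf hf0
  -- `E_ii - λ^♮_i` vanishes on the common kernel of the raising operators in `L(λ^♮)`. This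
  -- survives tensoring first with the dual factor on the right, then with `S` on the left.
  have hsing : LinearMap.lTensor (SuperSym (parity₂ p q) (𝔮 p q))
      ((W p q lam).act (upperLeft (Matrix.single i i 1)) -
        natWeight (p := p) (q := q) lam i • LinearMap.id) w = 0 := by
    refine lTensor_apply_eq_zero
      (I := {ij : (Fin p ⊕ Fin q) × (Fin p ⊕ Fin q) // ht ij.1 < ht ij.2})
      (φ := fun ij => (W p q lam).act (upperLeft (Matrix.single ij.1.1 ij.1.2 1)))
      (fun v hv => ?_) fun ij => hup _ _ ij.2
    have key := rTensor_apply_eq_zero (A := LSpace (natWeight (p := p) (q := q) lam))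
      (I := {ij : (Fin p ⊕ Fin q) × (Fin p ⊕ Fin q) // ht ij.1 < ht ij.2})
      (φ := fun ij => uAct (LSpace (natWeight lam)) (Matrix.single ij.1.1 ij.1.2 1))
      (θ := uAct (LSpace (natWeight lam)) (Matrix.single i i 1) - natWeight lam i • LinearMap.id)
      (fun v hv => ?_) (w := v) (fun ij => by rw [← W_act_upperLeft]; exact hv ij)
    · rw [LinearMap.rTensor_sub, LinearMap.rTensor_smul, LinearMap.rTensor_id,
        ← W_act_upperLeft] at key
      exact key
    · rw [LinearMap.sub_apply, singular_weight _ fun k l hkl => hv ⟨(k, l), hkl⟩]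
      simp
  -- With the indicator of `i`, the operator counts generators in column `i`. It is the difference
  -- of `E_ii` acting on `W_λ` alone, by `λ^♮_i`, and on the whole tensor product, by `μ^♮_i`.
  have hD : colDegree (W p q lam) (fun k => if k = i then 1 else 0) w =
      (natWeight lam i - natWeight mu i) • w := by
    rw [LinearMap.lTensor_sub, LinearMap.sub_apply, LinearMap.lTensor_smul, LinearMap.lTensor_id,
      LinearMap.smul_apply, LinearMap.id_apply, sub_eq_zero] at hsing
    rw [colDegree, diagonal_indicator, LinearMap.sub_apply, hsing, hdiag]
    exact (sub_smul _ _ _).symm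
  obtain ⟨n, hn⟩ := exists_nat_of_mem_natEig hD (natEig_colDegree _ _ w) hw0
  exact ⟨n, by linear_combination hn⟩

/-- Containment of hook partitions is determined by the weights `λ^♮`. -/
lemma le_of_natWeight {lam mu : YoungDiagram} (hmu : IsHook p q mu)
    (h : ∀ i : Fin p ⊕ Fin q, ∃ n : ℕ, natWeight lam i = natWeight mu i + n) : mu ≤ lam := by
  rintro ⟨i, j⟩ hij
  change (i, j) ∈ mu at hij
  by_cases hi : i < p
  · obtain ⟨n, hn⟩ := h (Sum.inl ⟨i, hi⟩)
    have hn' : lam.rowLen i = mu.rowLen i + n := by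
      simp only [natWeight, Sum.elim_inl] at hn
      exact_mod_cast hn
    rw [YoungDiagram.mem_iff_lt_rowLen] at hij ⊢
    omega
  -- Below row `p` the hook condition on `μ` confines the box to the first `q` columns, where
  -- `δ`-coordinates are available.
  · have hj : j < q := by
      have h1 := YoungDiagram.mem_iff_lt_rowLen.1 hij
      have h2 := mu.rowLen_anti p i (not_lt.1 hi)
      exact (h1.trans_le h2).trans_le hmu
    obtain ⟨n, hn⟩ := h (Sum.inr ⟨j, hj⟩)
    have hn' : lam.colLen j - p = mu.colLen j - p + n := by
      simp only [natWeight, Sum.elim_inr] at hn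
      exact_mod_cast hn
    -- The box has `p ≤ i < μ'_j`, so `μ'_j - p` is positive. Hence `λ'_j - p` is positive too, and
    -- neither subtraction is truncated.
    rw [YoungDiagram.mem_iff_lt_colLen] at hij ⊢
    omega

end Main

end SuperPair

theorem mainTheorem9 (p q : ℕ) (lam mu : YoungDiagram)
    (hlam : SuperPair.IsHook p q lam) (hmu : SuperPair.IsHook p q mu)
    (h : (SuperPair.W p q mu).Hom ((SuperPair.I p q lam).restrict (𝔰 := SuperPair.𝔨 p q) le_top) ≠ ⊥) :
    mu ≤ lam :=
  SuperPair.le_of_natWeight hmu (SuperPair.natWeight_sub_eq_natCast h)
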